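/- Let $\mathbb K$ be a field of characteristic zero. A properad is a graded $\mathbb S$-bimodule $\{E(m,n)\}_{m,n\ge 0}$ ($m$ outputs, $n$ inputs) with degree-zero compositions $\mu_G$, associative with respect to contraction of subgraphs, of the decorations of the vertices of every connected directed graph $G$ that has at least one vertex and no closed directed path, the legs of $G$ being labelled. For $m\ge 1$ let $C_\bullet(P_{m-1})$ be the cell complex of the $(m-1)$-dimensional permutahedron: its cells of dimension $m-k$ are the ordered partitions $(I_1,\dots,I_k)$ of $\{1,\dots,m\}$ into $k$ nonempty blocks, oriented by the increasing order in each block, so that $\mathbb S_m$ permutes them up to the product of the signs of the permutations $\sigma\colon I_j\to\sigma(I_j)$ of increasingly ordered sets, and $$\delta(I_1,\dots,I_k)=\sum_{i=1}^k\ \sum_{I_i=I_i'\sqcup I_i'',\ |I_i'|,|I_i''|\ge1}(-1)^{\,i+1+|I_1|+\dots+|I_{i-1}|+|I_i'|}\,\mathrm{sgn}(I_i\to I_i'\sqcup I_i'')\,(I_1,\dots,I_i',I_i'',\dots,I_k).$$ Let $C^\bullet(P_{m-1})=\mathrm{Hom}_{\mathbb K}(C_\bullet(P_{m-1}),\mathbb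 K)$ be the dual cochain complex (cochains on cells of dimension $d$ have degree $d$), and let $\check W$ be the dg $\mathbb S$-bimodule with $\check W(m,0)=\mathrm{sgn}_m\otimes C^\bullet(P_{m-1})[m]$ for $m\ge1$, $\check W(0,0)=0$, and $\check W(m,n)=0$ for $n\ge1$, where $V[m]^i=V^{i+m}$. It has a basis of generators $\langle I_1|\dots|I_k\rangle$ of degree $-k$, equal up to sign to the cochains dual to the cells, with $$\sigma\langle I_1|\dots|I_k\rangle=\langle \sigma I_1|\dots|\sigma I_k\rangle,\qquad \delta\langle I_1|\dots|I_k\rangle=\sum_{i=1}^{k-1}(-1)^{i+1}\langle I_1|\dots|I_i\sqcup I_{i+1}|\dots|I_k\rangle .$$ Let $\mathcal P=\Pi\mathcal P^\bullet$, the parity-shifted properad of permutahedra cochains, be the free dg properad generated by $\check W$; it is the properad which is free on $\check W$, with the differential that extends the differential of $\check W$. Then $\mathcal P$ exists, and its cohomology is the free properad generated by the corollas, one for each $m\ge1$, of degree $-m$ with $m$ skew-symmetric output legs and no input legs, represented by the signed sums over all vertices of the permutahedron $$\sum_{\sigma\in\mathbb S_m}(-1)^\sigma\,\langle\sigma(1)|\sigma(2)|\dots|\sigma(m)\rangle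 .$$ That is, these sums are cocycles, and their cohomology classes define a morphism of $\mathbb S$-bimodules to $H(\mathcal P)$ from the $\mathbb S$-bimodule that is $\mathrm{sgn}_m$ in degree $-m$ in arity $(m,0)$, $m\ge1$, and zero in the other arities; this morphism makes $H(\mathcal P)$ the free properad on that $\mathbb S$-bimodule. -/

import Mathlib

universe u

namespace Properadic

open Equiv

/-! ### Directed graphs with labelled legs -/

/-- A finite directed graph with `m` output legs and `n` input legs, labelled by `Fin m` and
`Fin n`. Its vertices are numbered by `Fin k`; the vertex `v` is an `(out v, inn v)`-corolla.
`wire` says where every edge ends: an edge starts at an output of a vertex or at an input leg of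
the graph, and it ends at an input of a vertex or at an output leg of the graph. -/
structure DirGraph (m n : ℕ) where
  k : ℕ
  out : Fin k → ℕ
  inn : Fin k → ℕ
  wire : ((Σ v : Fin k, Fin (out v)) ⊕ Fin n) ≃ ((Σ v : Fin k, Fin (inn v)) ⊕ Fin m)

namespace DirGraph

variable {m n : ℕ}

/-- There is an internal edge from `v` to `w`. -/
def Edge (G : DirGraph m n) (v w : Fin G.k) : Prop :=
  ∃ (a : Fin (G.out v)) (b : Fin (G.inn w)), G.wire (Sum.inl ⟨v, a⟩) = Sum.inl ⟨w, b⟩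

/-- The graphs that govern properads: built from at least one corolla (so that every leg is a leg
of a vertex), connected, and without closed directed paths. -/
structure IsProperadic (G : DirGraph m n) : Prop where
  pos : 0 < G.k
  noThrough : ∀ (i : Fin n) (j : Fin m), G.wire (Sum.inr i) ≠ Sum.inr j
  connected : ∀ v w, Relation.EqvGen G.Edge v w
  acyclic : ∀ v, ¬ Relation.TransGen G.Edge v v

/-- The one-vertex graph whose `a`-th output carries the label `σ a` and whose `b`-th input carries
the label `τ b`. -/
def corolla (σ : Perm (Fin m)) (τ : Perm (Fin n)) : DirGraph m n where
  k := 1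
  out _ := m
  inn _ := n
  wire := (Equiv.sumComm _ _).trans
    (Equiv.sumCongr (τ.symm.trans (Equiv.uniqueSigma fun _ : Fin 1 => Fin n).symm)
      ((Equiv.uniqueSigma fun _ : Fin 1 => Fin m).trans σ))

/-- The same graph with its vertices renumbered: the new vertex `v` is the old vertex `e v`. -/
def reorder (G : DirGraph m n) (e : Perm (Fin G.k)) : DirGraph m n where
  k := G.k
  out v := G.out (e v)
  inn v := G.inn (e v)
  wire := ((Equiv.sumCongr (Equiv.sigmaCongrLeft (β := fun v => Fin (G.out v)) e)
    (Equiv.refl _)).trans G.wire).trans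
    (Equiv.sumCongr (Equiv.sigmaCongrLeft (β := fun v => Fin (G.inn v)) e) (Equiv.refl _)).symm

/-- A wiring on the disjoint union of the vertices of the graphs `H w`, where `w` runs over the
vertices of `G`. -/
abbrev TotalWiring (G : DirGraph m n) (H : ∀ w, DirGraph (G.out w) (G.inn w)) : Type :=
  ((Σ x : (Σ w, Fin (H w).k), Fin ((H x.1).out x.2)) ⊕ Fin n) ≃
    ((Σ x : (Σ w, Fin (H w).k), Fin ((H x.1).inn x.2)) ⊕ Fin m)

/-- The graph given by a wiring on the disjoint union of the vertices of the graphs `H w`,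
numbered lexicographically. -/
def total (G : DirGraph m n) (H : ∀ w, DirGraph (G.out w) (G.inn w)) (W : G.TotalWiring H) :
    DirGraph m n where
  k := ∑ w, (H w).k
  out u := (H (finSigmaFinEquiv.symm u).1).out (finSigmaFinEquiv.symm u).2
  inn u := (H (finSigmaFinEquiv.symm u).1).inn (finSigmaFinEquiv.symm u).2
  wire := ((Equiv.sumCongr (Equiv.sigmaCongrLeft
      (β := fun x : (Σ w, Fin (H w).k) => Fin ((H x.1).out x.2)) finSigmaFinEquiv.symm)
      (Equiv.refl _)).trans W).trans
    (Equiv.sumCongr (Equiv.sigmaCongrLeft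
      (β := fun x : (Σ w, Fin (H w).k) => Fin ((H x.1).inn x.2)) finSigmaFinEquiv.symm)
      (Equiv.refl _)).symm

/-- The graph with wiring `W` contains each `H w` as a full subgraph, and `G` is the result of
shrinking each of these subgraphs to a vertex `w`. -/
structure IsContraction (G : DirGraph m n) (H : ∀ w, DirGraph (G.out w) (G.inn w))
    (W : G.TotalWiring H) : Prop where
  /-- internal edges of the `H w` -/
  inside : ∀ w v a v' b, (H w).wire (Sum.inl ⟨v, a⟩) = Sum.inl ⟨v', b⟩ →
    W (Sum.inl ⟨⟨w, v⟩, a⟩) = Sum.inl ⟨⟨w, v'⟩, b⟩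
  /-- internal edges of `G` -/
  between : ∀ w v a j w' i v' b, (H w).wire (Sum.inl ⟨v, a⟩) = Sum.inr j →
    G.wire (Sum.inl ⟨w, j⟩) = Sum.inl ⟨w', i⟩ → (H w').wire (Sum.inr i) = Sum.inl ⟨v', b⟩ →
    W (Sum.inl ⟨⟨w, v⟩, a⟩) = Sum.inl ⟨⟨w', v'⟩, b⟩
  /-- output legs -/
  outLeg : ∀ w v a j o, (H w).wire (Sum.inl ⟨v, a⟩) = Sum.inr j →
    G.wire (Sum.inl ⟨w, j⟩) = Sum.inr o → W (Sum.inl ⟨⟨w, v⟩, a⟩) = Sum.inr o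
  /-- input legs -/
  inLeg : ∀ l w i v b, G.wire (Sum.inr l) = Sum.inl ⟨w, i⟩ →
    (H w).wire (Sum.inr i) = Sum.inl ⟨v, b⟩ → W (Sum.inr l) = Sum.inl ⟨⟨w, v⟩, b⟩

end DirGraph

/-! ### S-bimodules and properads -/

/-- A graded S-bimodule over `K`. The group `S_m × S_n` acts from the left: `(σ, τ)` acts as
`x ↦ σ x τ⁻¹` in terms of commuting left and right actions. -/
structure SBimodule (K : Type u) [Field K] where
  X : ℕ → ℕ → Type u
  [addCommGroup : ∀ m n, AddCommGroup (X m n)]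
  [module : ∀ m n, Module K (X m n)]
  /-- the homogeneous elements of a given degree -/
  deg : ∀ m n, ℤ → Submodule K (X m n)
  isInternal : ∀ m n, DirectSum.IsInternal (deg m n)
  act : ∀ m n, Representation K (Perm (Fin m) × Perm (Fin n)) (X m n)
  act_mem : ∀ {m n} g {d x}, x ∈ deg m n d → act m n g x ∈ deg m n d

attribute [instance] SBimodule.addCommGroup SBimodule.module

/-- A differential graded S-bimodule, with a differential of degree `1`. -/
structure DGSBimodule (K : Type u) [Field K] extends SBimodule K where
  δ : ∀ m n, X m n →ₗ[K] X m n
  δ_mem : ∀ {m n d x}, x ∈ deg m n d → δ m n x ∈ deg m n (d + 1)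
  δ_δ : ∀ {m n} x, δ m n (δ m n x) = 0
  δ_act : ∀ {m n} g x, δ m n (act m n g x) = act m n g (δ m n x)

/-- Morphisms of S-bimodules, homogeneous of degree `0`. -/
structure SBimodule.Hom {K : Type u} [Field K] (E F : SBimodule K) where
  map : ∀ m n, E.X m n →ₗ[K] F.X m n
  map_mem : ∀ {m n d x}, x ∈ E.deg m n d → map m n x ∈ F.deg m n d
  map_act : ∀ {m n} g x, map m n (E.act m n g x) = F.act m n g (map m n x)

/-- The Koszul sign of the permutation `a_1 ⊗ … ⊗ a_k ↦ a_{e 1} ⊗ … ⊗ a_{e k}` for factors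
`a_i` of degree `d i`. -/
def koszulSign {k : ℕ} (d : Fin k → ℤ) (e : Perm (Fin k)) : ℤˣ :=
  ∏ i, ∏ j ∈ Finset.Ioi i, if e j < e i then (d (e i) * d (e j)).negOnePow else 1

/-- A properad: an S-bimodule with a composition `mu G` of decorations of `G` for every connected
directed graph `G` without closed directed paths. A decoration is a family of elements, one
for each vertex. The compositions have degree `0`, they respect the numbering of the vertices up
to the Koszul sign, one-vertex graphs act by relabelling of legs, and composition along a graph
agrees with the composition of its subgraphs followed by the composition along the contracted
graph. -/
structure Properad (K : Type u) [Field K] extends SBimodule K where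
  mu : ∀ {m n} (G : DirGraph m n), G.IsProperadic →
    MultilinearMap K (fun v => X (G.out v) (G.inn v)) (X m n)
  mu_mem : ∀ {m n} (G : DirGraph m n) (hG : G.IsProperadic) (d : Fin G.k → ℤ)
    (a : ∀ v, X (G.out v) (G.inn v)), (∀ v, a v ∈ deg _ _ (d v)) →
    mu G hG a ∈ deg m n (∑ v, d v)
  mu_corolla : ∀ {m n} (σ : Perm (Fin m)) (τ : Perm (Fin n))
    (h : (DirGraph.corolla σ τ).IsProperadic) (x : X m n),
    mu (DirGraph.corolla σ τ) h (fun _ => x) = act m n (σ, τ) x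
  mu_reorder : ∀ {m n} (G : DirGraph m n) (hG : G.IsProperadic) (e : Perm (Fin G.k))
    (he : (G.reorder e).IsProperadic) (d : Fin G.k → ℤ) (a : ∀ v, X (G.out v) (G.inn v)),
    (∀ v, a v ∈ deg _ _ (d v)) →
    mu (G.reorder e) he (fun v => a (e v)) = koszulSign d e • mu G hG a
  mu_total : ∀ {m n} (G : DirGraph m n) (hG : G.IsProperadic)
    (H : ∀ w, DirGraph (G.out w) (G.inn w)) (hH : ∀ w, (H w).IsProperadic)
    (W : G.TotalWiring H) (hW : (G.total H W).IsProperadic), G.IsContraction H W →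
    ∀ a : ∀ w v, X ((H w).out v) ((H w).inn v),
    mu (G.total H W) hW (fun u => a (finSigmaFinEquiv.symm u).1 (finSigmaFinEquiv.symm u).2) =
      mu G hG (fun w => mu (H w) (hH w) (a w))

/-- A differential graded properad: the compositions are compatible with the differential, which
acts on decorations by the signed Leibniz rule. -/
structure DGProperad (K : Type u) [Field K] extends Properad K, DGSBimodule K where
  leibniz : ∀ {m n} (G : DirGraph m n) (hG : G.IsProperadic) (d : Fin G.k → ℤ)
    (a : ∀ v, X (G.out v) (G.inn v)), (∀ v, a v ∈ deg _ _ (d v)) →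
    δ m n (mu G hG a) = ∑ v, (∑ w ∈ Finset.Iio v, d w).negOnePow •
      mu G hG (Function.update a v (δ _ _ (a v)))

/-- Morphisms of properads, homogeneous of degree `0`. -/
structure Properad.Hom {K : Type u} [Field K] (P Q : Properad K) extends
    SBimodule.Hom P.toSBimodule Q.toSBimodule where
  map_mu : ∀ {m n} (G : DirGraph m n) (hG : G.IsProperadic) (a : ∀ v, P.X (G.out v) (G.inn v)),
    map m n (P.mu G hG a) = Q.mu G hG (fun v => map _ _ (a v))

/-- `P` is the free properad generated by the S-bimodule `E`, with `ι` the inclusion of the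
generators: every morphism from `E` to a properad extends uniquely to a morphism from `P`. -/
def Properad.IsFree {K : Type u} [Field K] {E : SBimodule K} {P : Properad K}
    (ι : SBimodule.Hom E P.toSBimodule) : Prop :=
  ∀ (Q : Properad K) (f : SBimodule.Hom E Q.toSBimodule),
    ∃! g : Properad.Hom P Q, ∀ m n x, g.map m n (ι.map m n x) = f.map m n x

/-- `P` is the dg free properad generated by the dg S-bimodule `E`: it is free on `E`, and its
differential is the one given on the generators by the differential of `E`. -/
structure DGProperad.IsFree {K : Type u} [Field K] {E : DGSBimodule K} {P : DGProperad K}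
    (ι : SBimodule.Hom E.toSBimodule P.toSBimodule) : Prop where
  free : Properad.IsFree (P := P.toProperad) ι
  map_δ : ∀ m n x, P.δ m n (ι.map m n x) = ι.map m n (E.δ m n x)

/-! ### Cohomology of a dg properad -/

section Grading

variable {K : Type u} [Field K] {X : Type u} [AddCommGroup X] [Module K X]

/-- A family of submodules with compatible projections that spans is a grading. -/
theorem isInternal_of_proj (A : ℤ → Submodule K X) (p : ℤ → X →ₗ[K] X)
    (same : ∀ d x, x ∈ A d → p d x = x) (ne : ∀ d e x, x ∈ A e → d ≠ e → p d x = 0)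
    (top : iSup A = ⊤) : DirectSum.IsInternal A := by
  rw [DirectSum.isInternal_submodule_iff_iSupIndep_and_iSup_eq_top]
  refine ⟨fun d => ?_, top⟩
  rw [Submodule.disjoint_def]
  intro x hx hx'
  have h : (⨆ e, ⨆ (_ : e ≠ d), A e) ≤ LinearMap.ker (p d) :=
    iSup_le fun e => iSup_le fun he y hy => ne d e y hy (Ne.symm he)
  rw [← same d x hx]
  exact h hx'

theorem exists_proj {A : ℤ → Submodule K X} (h : DirectSum.IsInternal A) :
    ∃ p : ℤ → X →ₗ[K] X, (∀ d x, p d x ∈ A d) ∧ (∀ d x, x ∈ A d → p d x = x) ∧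
      (∀ d e x, x ∈ A e → d ≠ e → p d x = 0) ∧ ∀ x, ∃ s : Finset ℤ, x = ∑ d ∈ s, p d x := by
  classical
  let _ := h.chooseDecomposition
  refine ⟨fun d => (A d).subtype ∘ₗ DirectSum.component K ℤ (fun i => A i) d ∘ₗ
    (DirectSum.decomposeLinearEquiv A).toLinearMap, ?_, ?_, ?_, ?_⟩
  · intro d x
    exact Subtype.coe_prop _
  · intro d x hx
    exact DirectSum.decompose_of_mem_same A hx
  · intro d e x hx hne
    exact DirectSum.decompose_of_mem_ne A hx (Ne.symm hne)
  · intro x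
    exact ⟨_, (DirectSum.sum_support_decompose A x).symm⟩

/-- A multilinear map sends spans of sets into a submodule if it sends the sets into it. -/
theorem multilinear_mem_of_span {ι : Type} [Fintype ι] [DecidableEq ι] {M : ι → Type u}
    [∀ i, AddCommGroup (M i)] [∀ i, Module K (M i)] (f : MultilinearMap K M X)
    (N : Submodule K X) (S : ∀ i, Set (M i)) (hS : ∀ a, (∀ i, a i ∈ S i) → f a ∈ N)
    (a : ∀ i, M i) (ha : ∀ i, a i ∈ Submodule.span K (S i)) : f a ∈ N := by
  have key : ∀ (s : Finset ι) (a : ∀ i, M i), (∀ i ∈ s, a i ∈ Submodule.span K (S i)) →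
      (∀ i ∉ s, a i ∈ S i) → f a ∈ N := by
    intro s
    induction s using Finset.induction_on with
    | empty => exact fun a _ h => hS a fun i => h i (Finset.notMem_empty i)
    | insert j s hj ih =>
      intro a h1 h2
      have : ∀ x ∈ Submodule.span K (S j), f (Function.update a j x) ∈ N := by
        intro x hx
        induction hx using Submodule.span_induction with
        | mem x hx =>
          refine ih _ (fun i hi => ?_) (fun i hi => ?_)
          · have : i ≠ j := fun h => hj (h ▸ hi)
            rw [Function.update_of_ne this]
            exact h1 i (Finset.mem_insert_of_mem hi)
          · by_cases hij : i = j
            · subst hij; simpa using hx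
            · rw [Function.update_of_ne hij]
              exact h2 i (by simp [hij, hi])
        | zero => rw [f.map_update_zero]; exact N.zero_mem
        | add x y _ _ hx hy => rw [f.map_update_add]; exact N.add_mem hx hy
        | smul c x _ hx => rw [f.map_update_smul]; exact N.smul_mem _ hx
      simpa using this (a j) (h1 j (Finset.mem_insert_self _ _))
  exact key Finset.univ a (fun i _ => ha i) (fun i hi => absurd (Finset.mem_univ i) hi)

end Grading

namespace DGSBimodule

variable {K : Type u} [Field K] (E : DGSBimodule K) (m n : ℕ)

/-- The cocycles. -/
def cocycles : Submodule K (E.X m n) := LinearMap.ker (E.δ m n)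

/-- The coboundaries, as a submodule of the cocycles. -/
def coboundaries : Submodule K (E.cocycles m n) :=
  (LinearMap.range (E.δ m n)).comap (E.cocycles m n).subtype

/-- The cohomology: cocycles modulo coboundaries. -/
abbrev H : Type u := E.cocycles m n ⧸ E.coboundaries m n

/-- The cohomology class of a cocycle. -/
abbrev cls : E.cocycles m n →ₗ[K] E.H m n := (E.coboundaries m n).mkQ

/-- The cohomology classes of the cocycles of degree `d`. -/
def degH (d : ℤ) : Submodule K (E.H m n) :=
  ((E.deg m n d).comap (E.cocycles m n).subtype).map (E.cls m n)

variable {m n}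

theorem mem_cocycles {x : E.X m n} : x ∈ E.cocycles m n ↔ E.δ m n x = 0 := LinearMap.mem_ker

theorem cls_eq_iff {x y : E.cocycles m n} :
    E.cls m n x = E.cls m n y ↔ ∃ b, E.δ m n b = (x : E.X m n) - y := by
  rw [Submodule.mkQ_apply, Submodule.mkQ_apply, Submodule.Quotient.eq]
  rfl

theorem mem_degH {d : ℤ} {q : E.H m n} : q ∈ E.degH m n d ↔
    ∃ z : E.cocycles m n, (z : E.X m n) ∈ E.deg m n d ∧ E.cls m n z = q := Iff.rfl

theorem proj_comm {p : ℤ → E.X m n →ₗ[K] E.X m n}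
    (h1 : ∀ d x, p d x ∈ E.deg m n d) (h2 : ∀ d x, x ∈ E.deg m n d → p d x = x)
    (h3 : ∀ d e x, x ∈ E.deg m n e → d ≠ e → p d x = 0)
    (h4 : ∀ x, ∃ s : Finset ℤ, x = ∑ d ∈ s, p d x) (d : ℤ) (x : E.X m n) :
    E.δ m n (p d x) = p (d + 1) (E.δ m n x) := by
  have key : ∀ e y, y ∈ E.deg m n e → E.δ m n (p d y) = p (d + 1) (E.δ m n y) := by
    intro e y hy
    by_cases hde : d = e
    · subst hde
      rw [h2 _ _ hy, h2 _ _ (E.δ_mem hy)]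
    · rw [h3 _ _ _ hy hde, h3 (d + 1) (e + 1) _ (E.δ_mem hy) (by omega), map_zero]
  obtain ⟨s, hs⟩ := h4 x
  rw [hs]
  simp only [map_sum]
  exact Finset.sum_congr rfl fun e _ => key e _ (h1 e x)

theorem cocycles_le_span : E.cocycles m n ≤
    Submodule.span K {x | E.δ m n x = 0 ∧ ∃ d, x ∈ E.deg m n d} := by
  obtain ⟨p, h1, h2, h3, h4⟩ := exists_proj (E.isInternal m n)
  intro x hx
  obtain ⟨s, hs⟩ := h4 x
  rw [hs]
  refine Submodule.sum_mem _ fun d _ => Submodule.subset_span ⟨?_, d, h1 d x⟩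
  rw [E.proj_comm h1 h2 h3 h4, (E.mem_cocycles).1 hx, map_zero]

theorem range_le_span : LinearMap.range (E.δ m n) ≤
    Submodule.span K {x | ∃ d, ∃ y ∈ E.deg m n d, E.δ m n y = x} := by
  obtain ⟨p, h1, h2, h3, h4⟩ := exists_proj (E.isInternal m n)
  rintro _ ⟨x, rfl⟩
  obtain ⟨s, hs⟩ := h4 x
  rw [hs, map_sum]
  exact Submodule.sum_mem _ fun d _ => Submodule.subset_span ⟨d, _, h1 d x, rfl⟩

theorem isInternal_degH : DirectSum.IsInternal (E.degH m n) := by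
  obtain ⟨p, h1, h2, h3, h4⟩ := exists_proj (E.isInternal m n)
  have hc := E.proj_comm h1 h2 h3 h4
  have hZ : ∀ d, ∀ x ∈ E.cocycles m n, p d x ∈ E.cocycles m n := by
    intro d x hx
    rw [mem_cocycles, hc, (E.mem_cocycles).1 hx, map_zero]
  have hB : ∀ d, E.coboundaries m n ≤
      (E.coboundaries m n).comap ((p d).restrict (hZ d)) := by
    rintro d x ⟨y, hy⟩
    refine ⟨p (d - 1) y, ?_⟩
    rw [hc, hy, sub_add_cancel]
    rfl
  refine isInternal_of_proj _
    (fun d => (E.coboundaries m n).mapQ _ ((p d).restrict (hZ d)) (hB d)) ?_ ?_ ?_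
  · rintro d _ ⟨z, hz, rfl⟩
    refine congrArg (E.cls m n) (Subtype.ext ?_)
    exact h2 d z hz
  · rintro d e _ ⟨z, hz, rfl⟩ hne
    have : (p d).restrict (hZ d) z = 0 := Subtype.ext (h3 d e z hz hne)
    exact (congrArg (E.cls m n) this).trans (map_zero _)
  · rw [eq_top_iff]
    rintro q -
    obtain ⟨z, rfl⟩ := Submodule.mkQ_surjective _ q
    obtain ⟨s, hs⟩ := h4 z
    have : z = ∑ d ∈ s, (p d).restrict (hZ d) z := by
      apply Subtype.ext
      rw [AddSubmonoidClass.coe_finsetSum]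
      exact hs
    rw [this, map_sum]
    exact Submodule.sum_mem _ fun d _ => Submodule.mem_iSup_of_mem d ⟨_, h1 d z, rfl⟩

theorem act_cocycles (g) (x : E.X m n) (hx : x ∈ E.cocycles m n) :
    E.act m n g x ∈ E.cocycles m n := by
  rw [mem_cocycles, E.δ_act, (E.mem_cocycles).1 hx, map_zero]

/-- The S-bimodule of cohomology groups. -/
def cohomology : SBimodule K where
  X m n := E.H m n
  deg m n := E.degH m n
  isInternal _ _ := E.isInternal_degH
  act m n :=
    { toFun g := (E.coboundaries m n).mapQ (E.coboundaries m n)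
        ((E.act m n g).restrict (E.act_cocycles g)) (by
          rintro x ⟨y, hy⟩
          exact ⟨E.act m n g y, by rw [E.δ_act, hy]; rfl⟩)
      map_one' := by
        refine LinearMap.ext fun q => ?_
        obtain ⟨z, rfl⟩ := Submodule.mkQ_surjective _ q
        refine congrArg (E.cls m n) (Subtype.ext ?_)
        change E.act m n 1 z = z
        rw [map_one]; rfl
      map_mul' g h := by
        refine LinearMap.ext fun q => ?_
        obtain ⟨z, rfl⟩ := Submodule.mkQ_surjective _ q
        refine congrArg (E.cls m n) (Subtype.ext ?_)
        change E.act m n (g * h) z = E.act m n g (E.act m n h z)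
        rw [map_mul]; rfl }
  act_mem := by
    rintro m n g d _ ⟨z, hz, rfl⟩
    exact ⟨⟨_, E.act_cocycles g z z.2⟩, E.act_mem g hz, rfl⟩

end DGSBimodule

namespace DGProperad

variable {K : Type u} [Field K] (P : DGProperad K) {m n : ℕ}
  (G : DirGraph m n) (hG : G.IsProperadic)

theorem mu_cocycles (a : ∀ v, P.X (G.out v) (G.inn v)) (ha : ∀ v, a v ∈ P.cocycles _ _) :
    P.mu G hG a ∈ P.cocycles m n := by
  refine multilinear_mem_of_span (P.mu G hG) _ _ ?_ a fun v => P.cocycles_le_span (ha v)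
  intro a ha
  choose h d hd using ha
  rw [DGSBimodule.mem_cocycles, P.leibniz G hG d a hd]
  refine Finset.sum_eq_zero fun v _ => ?_
  rw [h v, (P.mu G hG).map_update_zero, smul_zero]

theorem mu_range (a : ∀ v, P.X (G.out v) (G.inn v)) (w : Fin G.k)
    (ha : ∀ v, v ≠ w → a v ∈ P.cocycles _ _) (hw : a w ∈ LinearMap.range (P.δ _ _)) :
    P.mu G hG a ∈ LinearMap.range (P.δ m n) := by
  classical
  let S : ∀ v, Set (P.X (G.out v) (G.inn v)) := fun v =>
    if v = w then {x | ∃ d, ∃ y ∈ P.deg _ _ d, P.δ _ _ y = x}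
    else {x | P.δ _ _ x = 0 ∧ ∃ d, x ∈ P.deg _ _ d}
  refine multilinear_mem_of_span (P.mu G hG) _ S ?_ a fun v => ?_
  · intro a ha
    have h1 : ∃ d, ∃ y ∈ P.deg (G.out w) (G.inn w) d, P.δ _ _ y = a w := by
      have := ha w
      simp only [S, if_true] at this
      exact this
    have h2 : ∀ v, v ≠ w → P.δ _ _ (a v) = 0 ∧ ∃ d, a v ∈ P.deg _ _ d := by
      intro v hv
      have := ha v
      simp only [S, if_neg hv] at this
      exact this
    obtain ⟨e, y, hy, hyw⟩ := h1
    have h3 : ∀ v, ∃ d, Function.update a w y v ∈ P.deg _ _ d := by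
      intro v
      by_cases hv : v = w
      · subst hv; exact ⟨e, by simpa using hy⟩
      · rw [Function.update_of_ne hv]; exact (h2 v hv).2
    choose d hd using h3
    have h4 := P.leibniz G hG d _ hd
    rw [Finset.sum_eq_single w] at h4
    · rw [Function.update_self, Function.update_idem, hyw, Function.update_eq_self] at h4
      refine ⟨(∑ u ∈ Finset.Iio w, d u).negOnePow • P.mu G hG (Function.update a w y), ?_⟩
      have h5 : ∀ (s : ℤˣ) (x : P.X m n), P.δ m n (s • x) = s • P.δ m n x := by
        intro s x
        rcases Int.units_eq_one_or s with rfl | rfl <;> simp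
      rw [h5, h4, smul_smul, Int.units_mul_self, one_smul]
    · intro v _ hv
      rw [Function.update_of_ne hv, (h2 v hv).1, (P.mu G hG).map_update_zero, smul_zero]
    · intro h; exact absurd (Finset.mem_univ w) h
  · by_cases hv : v = w
    · subst hv
      simp only [S, if_true]
      exact P.range_le_span hw
    · simp only [S, if_neg hv]
      exact P.cocycles_le_span (ha v hv)

/-- The composition of cocycles, as a cocycle. -/
def muZ (z : ∀ v, P.cocycles (G.out v) (G.inn v)) : P.cocycles m n :=
  ⟨P.mu G hG fun v => (z v : P.X _ _), P.mu_cocycles G hG _ fun v => (z v).2⟩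

theorem cls_muZ_congr (z z' : ∀ v, P.cocycles (G.out v) (G.inn v))
    (h : ∀ v, P.cls _ _ (z v) = P.cls _ _ (z' v)) :
    P.cls m n (P.muZ G hG z) = P.cls m n (P.muZ G hG z') := by
  classical
  have key : ∀ s : Finset (Fin G.k),
      P.cls m n (P.muZ G hG (s.piecewise z z')) = P.cls m n (P.muZ G hG z') := by
    intro s
    induction s using Finset.induction_on with
    | empty => simp
    | insert w s hw ih =>
      rw [← ih, DGSBimodule.cls_eq_iff]
      obtain ⟨b, hb⟩ := (P.cls_eq_iff).1 (h w)
      set a : ∀ v, P.X (G.out v) (G.inn v) := fun v => (s.piecewise z z' v : P.X _ _) with ha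
      have e1 : (fun v => ((insert w s).piecewise z z' v : P.X (G.out v) (G.inn v))) =
          Function.update a w (z w) := by
        funext v
        by_cases hv : v = w
        · subst hv; simp
        · rw [Function.update_of_ne hv, ha]
          simp only [Finset.piecewise, Finset.mem_insert, hv, false_or]
      have e2 : a = Function.update a w (z' w) := by
        funext v
        by_cases hv : v = w
        · subst hv; simp [ha, hw]
        · rw [Function.update_of_ne hv]
      change _ ∈ LinearMap.range (P.δ m n)
      change P.mu G hG _ - P.mu G hG a ∈ _
      rw [e1]
      conv in (P.mu G hG a) => rw [e2]
      rw [← (P.mu G hG).map_update_sub, ← hb]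
      refine P.mu_range G hG _ w (fun v hv => ?_) ?_
      · rw [Function.update_of_ne hv]; exact Subtype.coe_prop _
      · rw [Function.update_self]; exact ⟨b, rfl⟩
  simpa using key Finset.univ

theorem exists_rep (q : ∀ v, P.H (G.out v) (G.inn v)) :
    ∃ z : ∀ v, P.cocycles (G.out v) (G.inn v), (fun v => P.cls _ _ (z v)) = q := by
  choose z hz using fun v => Submodule.mkQ_surjective _ (q v)
  exact ⟨z, funext hz⟩

/-- The composition of cohomology classes, defined through representatives. -/
noncomputable def muH : MultilinearMap K (fun v => P.H (G.out v) (G.inn v)) (P.H m n) :=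
  MultilinearMap.mk'
    (fun q => P.cls m n (P.muZ G hG fun v => Function.surjInv (Submodule.mkQ_surjective _) (q v)))
    (by
      intro q w x y
      obtain ⟨z, rfl⟩ := P.exists_rep G q
      obtain ⟨x, rfl⟩ := Submodule.mkQ_surjective _ x
      obtain ⟨y, rfl⟩ := Submodule.mkQ_surjective _ y
      have key : ∀ t : P.cocycles (G.out w) (G.inn w), P.cls m n (P.muZ G hG fun v =>
          Function.surjInv (Submodule.mkQ_surjective _)
            (Function.update (fun v => P.cls _ _ (z v)) w (P.cls _ _ t) v)) =
          P.cls m n (P.muZ G hG (Function.update z w t)) := by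
        intro t
        refine P.cls_muZ_congr G hG _ _ fun v => ?_
        rw [DGSBimodule.cls, Function.surjInv_eq (Submodule.mkQ_surjective _)]
        by_cases hv : v = w
        · subst hv; simp
        · simp [Function.update_of_ne hv]
      rw [← map_add (P.cls _ _), key, key, key, ← map_add]
      refine congrArg _ (Subtype.ext ?_)
      have e : ∀ t : P.cocycles (G.out w) (G.inn w), (P.muZ G hG (Function.update z w t) : P.X m n)
          = P.mu G hG (Function.update (fun v => (z v : P.X _ _)) w t) := by
        intro t
        refine congrArg (P.mu G hG) (funext fun v => ?_)
        by_cases hv : v = w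
        · subst hv; simp
        · simp [Function.update_of_ne hv]
      rw [Submodule.coe_add, e, e, e, Submodule.coe_add, MultilinearMap.map_update_add])
    (by
      intro q w c x
      obtain ⟨z, rfl⟩ := P.exists_rep G q
      obtain ⟨x, rfl⟩ := Submodule.mkQ_surjective _ x
      have key : ∀ t : P.cocycles (G.out w) (G.inn w), P.cls m n (P.muZ G hG fun v =>
          Function.surjInv (Submodule.mkQ_surjective _)
            (Function.update (fun v => P.cls _ _ (z v)) w (P.cls _ _ t) v)) =
          P.cls m n (P.muZ G hG (Function.update z w t)) := by
        intro t
        refine P.cls_muZ_congr G hG _ _ fun v => ?_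
        rw [DGSBimodule.cls, Function.surjInv_eq (Submodule.mkQ_surjective _)]
        by_cases hv : v = w
        · subst hv; simp
        · simp [Function.update_of_ne hv]
      rw [← map_smul (P.cls _ _), key, key, ← map_smul]
      refine congrArg _ (Subtype.ext ?_)
      have e : ∀ t : P.cocycles (G.out w) (G.inn w), (P.muZ G hG (Function.update z w t) : P.X m n)
          = P.mu G hG (Function.update (fun v => (z v : P.X _ _)) w t) := by
        intro t
        refine congrArg (P.mu G hG) (funext fun v => ?_)
        by_cases hv : v = w
        · subst hv; simp
        · simp [Function.update_of_ne hv]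
      rw [Submodule.coe_smul, e, e, Submodule.coe_smul, MultilinearMap.map_update_smul])

theorem muH_cls (z : ∀ v, P.cocycles (G.out v) (G.inn v)) :
    P.muH G hG (fun v => P.cls _ _ (z v)) = P.cls m n (P.muZ G hG z) :=
  P.cls_muZ_congr G hG _ _ fun _ => Function.surjInv_eq (Submodule.mkQ_surjective _) _

/-- The cohomology of a dg properad, with the induced properad structure. -/
noncomputable def cohomology : Properad K where
  toSBimodule := P.toDGSBimodule.cohomology
  mu G hG := P.muH G hG
  mu_mem := by
    intro m n G hG d q hq
    choose z hz hzq using hq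
    obtain rfl : (fun v => P.cls _ _ (z v)) = q := funext hzq
    exact ⟨P.muZ G hG z, P.mu_mem G hG d _ hz, (P.muH_cls G hG z).symm⟩
  mu_corolla := by
    intro m n σ τ h q
    obtain ⟨z, rfl⟩ := Submodule.mkQ_surjective _ q
    refine (P.muH_cls (DirGraph.corolla σ τ) h fun _ => z).trans ?_
    exact congrArg (P.cls m n) (Subtype.ext (P.mu_corolla σ τ h z))
  mu_reorder := by
    intro m n G hG e he d q hq
    choose z hz hzq using hq
    obtain rfl : (fun v => P.cls _ _ (z v)) = q := funext hzq
    refine (P.muH_cls (G.reorder e) he fun v => z (e v)).trans ?_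
    have h := P.mu_reorder G hG e he d _ hz
    refine Eq.trans ?_ (congrArg (koszulSign d e • ·) (P.muH_cls G hG z)).symm
    change _ = koszulSign d e • P.cls m n (P.muZ G hG z)
    rcases Int.units_eq_one_or (koszulSign d e) with hs | hs
    · rw [hs, one_smul] at h ⊢
      exact congrArg (P.cls m n) (Subtype.ext h)
    · rw [hs, Units.neg_smul, one_smul] at h ⊢
      rw [← map_neg]
      exact congrArg (P.cls m n) (Subtype.ext h)
  mu_total := by
    intro m n G hG H hH W hW hc q
    choose z hz using fun w v => Submodule.mkQ_surjective _ (q w v)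
    obtain rfl : (fun w v => P.cls _ _ (z w v)) = q := funext fun w => funext (hz w)
    refine (P.muH_cls (G.total H W) hW
      fun u => z (finSigmaFinEquiv.symm u).1 (finSigmaFinEquiv.symm u).2).trans ?_
    have h1 : (fun w => P.muH (H w) (hH w) (fun v => P.cls _ _ (z w v))) =
        fun w => P.cls _ _ (P.muZ (H w) (hH w) (z w)) :=
      funext fun w => P.muH_cls (H w) (hH w) (z w)
    refine Eq.trans ?_ (congrArg (P.muH G hG) h1).symm
    refine Eq.trans ?_ (P.muH_cls G hG fun w => P.muZ (H w) (hH w) (z w)).symm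
    have h2 := P.mu_total G hG H hH W hW hc
      fun w v => (P.cocycles ((H w).out v) ((H w).inn v)).subtype (z w v)
    exact congrArg (P.cls m n) (Subtype.ext h2)

end DGProperad

/-! ### The cells of the permutahedra -/

/-- A cell of the permutahedron `P_{m-1}`: an ordered partition of `Fin m` into `k` nonempty
blocks `I_j = f⁻¹ {j}`, with the orientation given by the increasing order in each block. Its
dimension is `m - k`. These are `(m, 0)`-corollas, so there are no cells for `n ≥ 1`. -/
structure Cell (m n : ℕ) where
  k : ℕ
  f : Fin m → Fin k
  surj : Function.Surjective f
  pos : 0 < m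
  hn : n = 0

section Signs

variable {m k : ℕ}

/-- The sign of the permutation `(I_0, …, I_{k-1})` of `Fin m`, the blocks being written one after
the other, each in increasing order. -/
def concatSign (f : Fin m → Fin k) : ℤˣ :=
  ∏ x, ∏ y ∈ Finset.Ioi x, if f y < f x then -1 else 1

/-- The product over the blocks `I_j` of the signs of the permutations `σ : I_j → σ I_j`, where
`I_j` and `σ I_j` are ordered increasingly. -/
def orientSign (σ : Perm (Fin m)) (f : Fin m → Fin k) : ℤˣ :=
  ∏ x, ∏ y ∈ Finset.Ioi x, if f x = f y ∧ σ y < σ x then -1 else 1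

/-- The sign with which the cell `g = (I_0, …, I_i', I_i'', …, I_{k-1})` appears in the boundary of
`(I_0, …, I_{k-1})`, where `I_i = I_i' ⊔ I_i''`: the product of `(-1) ^ i`, of
`(-1) ^ (|I_0| + … + |I_{i-1}| + |I_i'|)`, and of the sign of the permutation
`I_i → (I_i', I_i'')`. -/
def splitSign (i : Fin k) (g : Fin m → Fin (k + 1)) : ℤˣ :=
  (-1) ^ (i : ℕ) * (-1) ^ (Finset.univ.filter fun x => g x ≤ i.castSucc).card *
    ∏ x, ∏ y ∈ Finset.Ioi x, if g x = i.succ ∧ g y = i.castSucc then -1 else 1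

/-- The sign `sgn (I_0, …, I_{k-1}) · ∏_j (-1) ^ (|I_0| + … + |I_j|)`. -/
def boxSign (f : Fin m → Fin k) : ℤˣ :=
  concatSign f * ∏ j, (-1) ^ (Finset.univ.filter fun x => f x ≤ j).card

theorem concatSign_comp (σ : Perm (Fin m)) (f : Fin m → Fin k) :
    orientSign σ f * concatSign f = Perm.sign σ * concatSign (f ∘ σ.symm) := by
  let A : Fin m → Fin m → ℤ := fun x y =>
    if x = y then 0 else if f (σ.symm x) = f (σ.symm y) then (if x < y then 1 else -1)
    else if f (σ.symm x) < f (σ.symm y) then 1 else -1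
  have hA : ∀ x y, A x y = - A y x := by
    intro x y
    simp only [A]
    grind
  have h := σ.prod_Ioi_comp_eq_sign_mul_prod hA
  have h1 : ∏ x, ∏ y ∈ Finset.Ioi x, A x y = ((concatSign (f ∘ σ.symm) : ℤˣ) : ℤ) := by
    rw [concatSign, Units.coe_prod]
    refine Finset.prod_congr rfl fun x _ => ?_
    rw [Units.coe_prod]
    refine Finset.prod_congr rfl fun y hy => ?_
    rw [Finset.mem_Ioi] at hy
    simp only [A, Function.comp_apply]
    split_ifs <;> first | rfl | (exfalso; grind)
  have h2 : ∏ x, ∏ y ∈ Finset.Ioi x, A (σ x) (σ y) =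
      ((orientSign σ f * concatSign f : ℤˣ) : ℤ) := by
    rw [orientSign, concatSign, ← Finset.prod_mul_distrib, Units.coe_prod]
    refine Finset.prod_congr rfl fun x _ => ?_
    rw [← Finset.prod_mul_distrib, Units.coe_prod]
    refine Finset.prod_congr rfl fun y hy => ?_
    rw [Finset.mem_Ioi] at hy
    have : σ x ≠ σ y := fun h => hy.ne (σ.injective h)
    simp only [A, symm_apply_apply]
    split_ifs <;> first | rfl | (exfalso; grind)
  ext
  rw [← h2, h, h1]
  simp

theorem predAbove_val (i : Fin k) (u : Fin (k + 1)) :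
    ((i.predAbove u : Fin k) : ℕ) = if (u : ℕ) ≤ i then (u : ℕ) else u - 1 := by
  rcases le_or_gt u i.castSucc with h | h
  · rw [Fin.predAbove_of_le_castSucc _ _ h]
    exact (if_pos (show (u : ℕ) ≤ i from h)).symm
  · rw [Fin.predAbove_of_castSucc_lt _ _ h]
    exact (if_neg (show ¬ (u : ℕ) ≤ i from not_le.2 h)).symm

theorem concatSign_predAbove (i : Fin k) (g : Fin m → Fin (k + 1)) :
    concatSign g = concatSign (i.predAbove ∘ g) *
      ∏ x, ∏ y ∈ Finset.Ioi x, if g x = i.succ ∧ g y = i.castSucc then -1 else 1 := by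
  simp only [concatSign]
  rw [← Finset.prod_mul_distrib]
  refine Finset.prod_congr rfl fun x _ => ?_
  rw [← Finset.prod_mul_distrib]
  refine Finset.prod_congr rfl fun y _ => ?_
  have h := predAbove_val i
  simp only [Function.comp_apply, Fin.lt_def, h, Fin.ext_iff, Fin.val_succ, Fin.val_castSucc]
  split_ifs <;> first | rfl | (exfalso; omega)

theorem boxSign_predAbove (i : Fin k) (g : Fin m → Fin (k + 1)) :
    splitSign i g = (-1) ^ (i : ℕ) * boxSign g * boxSign (i.predAbove ∘ g) := by
  have h := predAbove_val i
  have h1 : ∀ j : Fin k, (Finset.univ.filter fun x => g x ≤ i.castSucc.succAbove j) =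
      Finset.univ.filter fun x => (i.predAbove ∘ g) x ≤ j := by
    intro j
    ext x
    simp only [Finset.mem_filter, Finset.mem_univ, true_and, Function.comp_apply, Fin.le_def, h,
      Fin.succAbove, Fin.lt_def, Fin.val_castSucc]
    split_ifs <;> simp only [Fin.val_succ, Fin.val_castSucc] <;> omega
  simp only [splitSign, boxSign]
  rw [Fin.prod_univ_succAbove _ i.castSucc, concatSign_predAbove i g]
  simp only [h1]
  have aux : ∀ a b c d e : ℤˣ, c * d * e = c * (a * e * (d * b)) * (a * b) := by decide
  exact aux _ _ _ _ _

theorem orientSign_eq (σ : Perm (Fin m)) (f : Fin m → Fin k) :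
    orientSign σ f = Perm.sign σ * boxSign f * boxSign (f ∘ σ.symm) := by
  have h1 : ∀ j : Fin k, (Finset.univ.filter fun x => (f ∘ σ.symm) x ≤ j).card =
      (Finset.univ.filter fun x => f x ≤ j).card := by
    intro j
    refine Finset.card_bij (fun x _ => σ.symm x) ?_ ?_ ?_
    · intro x hx; simpa using hx
    · intro x _ y _ h; exact σ.symm.injective h
    · intro y hy; exact ⟨σ y, by simpa using hy, by simp⟩
  have h := concatSign_comp σ f
  simp only [boxSign, h1]
  set a := concatSign f
  set b := ∏ j, (-1 : ℤˣ) ^ (Finset.univ.filter fun x => f x ≤ j).card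
  have ha : a * a = 1 := Int.units_mul_self a
  have hb : b * b = 1 := Int.units_mul_self b
  calc orientSign σ f = orientSign σ f * (a * a) * (b * b) := by rw [ha, hb, mul_one, mul_one]
    _ = (orientSign σ f * a) * a * (b * b) := by simp only [mul_assoc]
    _ = _ := by rw [h]; simp only [mul_comm, mul_left_comm, mul_assoc]

end Signs

/-! ### The cell complex of the permutahedra -/

namespace Cell

variable {m n : ℕ}

/-- The cell with relabelled vertices: the blocks `I_j` become `σ I_j`. -/
def relabel (σ : Perm (Fin m)) (c : Cell m n) : Cell m n :=
  ⟨c.k, c.f ∘ σ.symm, c.surj.comp σ.symm.surjective, c.pos, c.hn⟩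

theorem k_le (c : Cell m n) : c.k ≤ m := by
  simpa using Fintype.card_le_of_surjective c.f c.surj

variable (K : Type u) [Field K]

/-- The boundary of an oriented cell: the signed sum over all splittings of a block `I_i` into
two nonempty blocks `I_i'`, `I_i''`. -/
noncomputable def boundary (c : Cell m n) : Cell m n →₀ K :=
  ∑ i : Fin c.k, ∑ g : Fin m → Fin (c.k + 1),
    if h : Function.Surjective g ∧ i.predAbove ∘ g = c.f then
      Finsupp.single ⟨c.k + 1, g, h.1, c.pos, c.hn⟩ ((splitSign i g : ℤ) : K) else 0

/-- The boundary operator of the complex of oriented cells. -/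
noncomputable def bdry (m n : ℕ) : (Cell m n →₀ K) →ₗ[K] (Cell m n →₀ K) :=
  Finsupp.linearCombination K (boundary K)

/-- The action of a permutation on the oriented cells. -/
noncomputable def relabelMap (n : ℕ) (σ : Perm (Fin m)) :
    (Cell m n →₀ K) →ₗ[K] (Cell m n →₀ K) :=
  Finsupp.linearCombination K
    fun c => Finsupp.single (c.relabel σ) ((orientSign σ c.f : ℤ) : K)

/-- The basis element of a map to `Fin k`, zero if the map is not surjective. -/
noncomputable def bas (hm : 0 < m) (hn : n = 0) {k : ℕ} (f : Fin m → Fin k) : Cell m n →₀ K :=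
  if h : Function.Surjective f then Finsupp.single ⟨k, f, h, hm, hn⟩ 1 else 0

theorem single_eq_bas (c : Cell m n) (r : K) :
    Finsupp.single c r = r • bas K c.pos c.hn c.f := by
  rw [bas, dif_pos c.surj, Finsupp.smul_single, smul_eq_mul, mul_one]

theorem units_mul_self (s : ℤˣ) : ((s : ℤ) : K) * ((s : ℤ) : K) = 1 := by
  rcases Int.units_eq_one_or s with rfl | rfl <;> simp

theorem boundary_eq (c : Cell m n) : boundary K c = ((boxSign c.f : ℤ) : K) •
    ∑ i : Fin c.k, ∑ g : Fin m → Fin (c.k + 1), if i.predAbove ∘ g = c.f then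
      ((((-1) ^ (i : ℕ) * boxSign g : ℤˣ) : ℤ) : K) • bas K c.pos c.hn g else 0 := by
  rw [boundary, Finset.smul_sum]
  refine Finset.sum_congr rfl fun i _ => ?_
  rw [Finset.smul_sum]
  refine Finset.sum_congr rfl fun g _ => ?_
  by_cases h1 : i.predAbove ∘ g = c.f
  · rw [if_pos h1]
    by_cases h2 : Function.Surjective g
    · rw [dif_pos ⟨h2, h1⟩, single_eq_bas, smul_smul]
      congr 1
      rw [boxSign_predAbove, h1]
      push_cast
      ring
    · rw [dif_neg (fun h => h2 h.1), bas, dif_neg h2, smul_zero, smul_zero]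
  · rw [if_neg h1, dif_neg (fun h => h1 h.2), smul_zero]

theorem bdry_bas (hm : 0 < m) (hn : n = 0) {k : ℕ} (f : Fin m → Fin k) :
    bdry K m n (bas K hm hn f) = ((boxSign f : ℤ) : K) •
    ∑ i : Fin k, ∑ g : Fin m → Fin (k + 1), if i.predAbove ∘ g = f then
      ((((-1) ^ (i : ℕ) * boxSign g : ℤˣ) : ℤ) : K) • bas K hm hn g else 0 := by
  by_cases hf : Function.Surjective f
  · conv_lhs => rw [bas, dif_pos hf, bdry, Finsupp.linearCombination_single, one_smul]
    exact boundary_eq K ⟨k, f, hf, hm, hn⟩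
  · conv_lhs => rw [bas, dif_neg hf, map_zero]
    symm
    refine smul_eq_zero_of_right _ ?_
    refine Finset.sum_eq_zero fun i _ => Finset.sum_eq_zero fun g _ => ?_
    split_ifs with h
    · rw [bas, dif_neg, smul_zero]
      intro hg
      exact hf (h ▸ (Fin.predAbove_surjective i).comp hg)
    · rfl

/-- Merging two neighbouring blocks twice, with signs, gives zero. -/
theorem sum_merge_merge {k : ℕ} (f : Fin m → Fin k) (h : Fin m → Fin (k + 2)) :
    ∑ x : Fin k × Fin (k + 1), (if x.1.predAbove ∘ x.2.predAbove ∘ h = f then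
      ((((-1) ^ (x.1 : ℕ) * (-1) ^ (x.2 : ℕ) : ℤˣ) : ℤ) : K) else 0) = 0 := by
  let t : Fin k × Fin (k + 1) → Fin k × Fin (k + 1) := fun x =>
    if hx : (x.2 : ℕ) ≤ x.1 then (⟨x.2, by omega⟩, x.1.succ)
    else (⟨x.2 - 1, by omega⟩, x.1.castSucc)
  have hcomp : ∀ x, (t x).1.predAbove ∘ (t x).2.predAbove ∘ h =
      x.1.predAbove ∘ x.2.predAbove ∘ h := by
    rintro ⟨i, j⟩
    funext u
    simp only [Function.comp_apply, Fin.ext_iff, predAbove_val, t]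
    have := (h u).isLt
    split_ifs <;> simp_all <;> omega
  have hsign : ∀ x, ((-1) ^ ((t x).1 : ℕ) * (-1) ^ ((t x).2 : ℕ) : ℤˣ) =
      - ((-1) ^ (x.1 : ℕ) * (-1) ^ (x.2 : ℕ)) := by
    rintro ⟨i, j⟩
    simp only [t]
    split_ifs with hx
    · simp only [Fin.val_succ, pow_succ]
      rw [mul_neg_one, mul_neg, mul_comm]
    · simp only [Fin.val_castSucc]
      obtain ⟨r, hr⟩ : ∃ r, (j : ℕ) = r + 1 := ⟨j - 1, by omega⟩
      rw [hr, Nat.add_sub_cancel, pow_succ, mul_neg_one, mul_neg, neg_neg, mul_comm]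
  refine Finset.sum_involution (fun x _ => t x) ?_ ?_ ?_ ?_
  · intro x _
    rw [hcomp, hsign]
    split_ifs <;> simp
  · rintro ⟨i, j⟩ _ _ heq
    simp only [t] at heq
    split_ifs at heq with hx <;> simp only [Prod.mk.injEq, Fin.ext_iff, Fin.val_succ,
      Fin.val_castSucc] at heq hx <;> omega
  · intro x _; exact Finset.mem_univ _
  · rintro ⟨i, j⟩ _
    by_cases hx : (j : ℕ) ≤ i
    · have h1 : t (i, j) = (⟨j, by omega⟩, i.succ) := dif_pos hx
      rw [h1]
      refine (dif_neg (by simp only [Fin.val_succ]; omega)).trans ?_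
      simp
    · have h1 : t (i, j) = (⟨j - 1, by omega⟩, i.castSucc) := dif_neg hx
      rw [h1]
      refine (dif_pos (by simp only [Fin.val_castSucc]; omega)).trans ?_
      simp only [Prod.mk.injEq, Fin.ext_iff, Fin.val_succ, Fin.val_castSucc]
      exact ⟨trivial, by omega⟩

theorem bdry_bdry (x : Cell m n →₀ K) : bdry K m n (bdry K m n x) = 0 := by
  induction x using Finsupp.induction_linear with
  | zero => simp
  | add x y hx hy => rw [map_add, map_add, hx, hy, add_zero]
  | single c r =>
    rw [single_eq_bas, map_smul, map_smul, bdry_bas]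
    refine smul_eq_zero_of_right _ ?_
    rw [map_smul]
    refine smul_eq_zero_of_right _ ?_
    simp only [map_sum, apply_ite (bdry K m n), map_smul, map_zero, bdry_bas]
    have key : ∀ (i : Fin c.k) (g : Fin m → Fin (c.k + 1)),
        (if i.predAbove ∘ g = c.f then ((((-1) ^ (i : ℕ) * boxSign g : ℤˣ) : ℤ) : K) •
          ((boxSign g : ℤ) : K) • ∑ j : Fin (c.k + 1), ∑ h : Fin m → Fin (c.k + 2),
            (if j.predAbove ∘ h = g then
              ((((-1) ^ (j : ℕ) * boxSign h : ℤˣ) : ℤ) : K) • bas K c.pos c.hn h else 0)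
          else 0) =
        ∑ j : Fin (c.k + 1), ∑ h : Fin m → Fin (c.k + 2), if j.predAbove ∘ h = g then
          ((if i.predAbove ∘ j.predAbove ∘ h = c.f then
            ((((-1) ^ (i : ℕ) * (-1) ^ (j : ℕ) : ℤˣ) : ℤ) : K) else 0) •
            ((boxSign h : ℤ) : K) • bas K c.pos c.hn h) else 0 := by
      intro i g
      split_ifs with hg
      · rw [smul_smul, Finset.smul_sum]
        refine Finset.sum_congr rfl fun j _ => ?_
        rw [Finset.smul_sum]
        refine Finset.sum_congr rfl fun h _ => ?_
        by_cases hh : j.predAbove ∘ h = g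
        · rw [if_pos hh, if_pos hh, hh, if_pos hg, smul_smul, smul_smul]
          congr 1
          have := units_mul_self K (boxSign g)
          push_cast
          linear_combination (-1) ^ (i : ℕ) * (-1) ^ (j : ℕ) * ((boxSign h : ℤ) : K) * this
        · rw [if_neg hh, if_neg hh, smul_zero]
      · symm
        refine Finset.sum_eq_zero fun j _ => Finset.sum_eq_zero fun h _ => ?_
        split_ifs with hh h3
        · exact absurd (hh ▸ h3) hg
        · rw [zero_smul]
        · rfl
    simp only [key]
    have e1 : ∀ i : Fin c.k, (∑ g : Fin m → Fin (c.k + 1), ∑ j : Fin (c.k + 1),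
        ∑ h : Fin m → Fin (c.k + 2), if j.predAbove ∘ h = g then
          ((if i.predAbove ∘ j.predAbove ∘ h = c.f then
            ((((-1) ^ (i : ℕ) * (-1) ^ (j : ℕ) : ℤˣ) : ℤ) : K) else 0) •
            ((boxSign h : ℤ) : K) • bas K c.pos c.hn h) else 0) =
        ∑ h : Fin m → Fin (c.k + 2), ∑ j : Fin (c.k + 1),
          (if i.predAbove ∘ j.predAbove ∘ h = c.f then
            ((((-1) ^ (i : ℕ) * (-1) ^ (j : ℕ) : ℤˣ) : ℤ) : K) else 0) •
            ((boxSign h : ℤ) : K) • bas K c.pos c.hn h := by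
      intro i
      rw [Finset.sum_comm]
      rw [Finset.sum_comm (s := (Finset.univ : Finset (Fin m → Fin (c.k + 2))))]
      refine Finset.sum_congr rfl fun j _ => ?_
      rw [Finset.sum_comm]
      refine Finset.sum_congr rfl fun h _ => ?_
      rw [Finset.sum_ite_eq]
      simp
    simp only [e1]
    rw [Finset.sum_comm]
    refine Finset.sum_eq_zero fun h _ => ?_
    simp only [← Finset.sum_smul]
    rw [← Fintype.sum_prod_type', sum_merge_merge, zero_smul]

theorem relabelMap_bas (hm : 0 < m) (hn : n = 0) (σ : Perm (Fin m)) {k : ℕ} (f : Fin m → Fin k) :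
    relabelMap K n σ (bas K hm hn f) =
      ((orientSign σ f : ℤ) : K) • bas K hm hn (f ∘ σ.symm) := by
  by_cases hf : Function.Surjective f
  · conv_lhs => rw [bas, dif_pos hf, relabelMap, Finsupp.linearCombination_single, one_smul]
    rw [single_eq_bas]
    rfl
  · have : ¬ Function.Surjective (f ∘ σ.symm) := fun h => hf h.of_comp
    rw [bas, bas, dif_neg hf, dif_neg this, map_zero, smul_zero]

theorem relabelMap_bdry (σ : Perm (Fin m)) (x : Cell m n →₀ K) :
    relabelMap K n σ (bdry K m n x) = bdry K m n (relabelMap K n σ x) := by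
  induction x using Finsupp.induction_linear with
  | zero => simp
  | add x y hx hy => simp only [map_add, hx, hy]
  | single c r =>
    rw [single_eq_bas]
    simp only [map_smul, bdry_bas, relabelMap_bas, map_sum, apply_ite (relabelMap K n σ), map_zero]
    congr 1
    rw [smul_smul, Finset.smul_sum, Finset.smul_sum]
    refine Finset.sum_congr rfl fun i _ => ?_
    rw [Finset.smul_sum, Finset.smul_sum]
    refine Fintype.sum_equiv (σ.arrowCongr (Equiv.refl _)) _ _ fun g => ?_
    have hg : (σ.arrowCongr (Equiv.refl _)) g = g ∘ σ.symm := rfl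
    have hiff : i.predAbove ∘ g ∘ σ.symm = c.f ∘ σ.symm ↔ i.predAbove ∘ g = c.f := by
      rw [← Function.comp_assoc]
      exact σ.symm.surjective.injective_comp_right.eq_iff
    rw [hg]
    simp only [hiff]
    split_ifs
    · rw [smul_smul, smul_smul, smul_smul, orientSign_eq, orientSign_eq]
      congr 1
      have h1 := units_mul_self K (boxSign g)
      have h2 := units_mul_self K (boxSign (c.f ∘ σ.symm))
      push_cast
      linear_combination
        ((boxSign c.f : ℤ) : K) * (-1) ^ (i : ℕ) * ((Perm.sign σ : ℤ) : K) *
          ((boxSign (g ∘ σ.symm) : ℤ) : K) * (h1 - h2)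
    · rw [smul_zero, smul_zero]

/-- The action of `S_m` (and, trivially, of `S_n`) on the complex of oriented cells. -/
noncomputable def rep (m n : ℕ) :
    Representation K (Perm (Fin m) × Perm (Fin n)) (Cell m n →₀ K) where
  toFun g := relabelMap K n g.1
  map_one' := by
    refine Finsupp.lhom_ext fun c r => ?_
    rw [single_eq_bas, map_smul, relabelMap_bas, orientSign_eq]
    have h2 := units_mul_self K (boxSign c.f)
    have h3 : c.f ∘ (1 : Perm (Fin m) × Perm (Fin n)).1.symm = c.f := rfl
    rw [h3]
    simp
  map_mul' g h := by
    refine Finsupp.lhom_ext fun c r => ?_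
    rw [single_eq_bas, Module.End.mul_apply]
    simp only [map_smul, relabelMap_bas]
    have h3 : c.f ∘ (g * h).1.symm = (c.f ∘ h.1.symm) ∘ g.1.symm := rfl
    rw [h3, smul_smul ((orientSign h.1 c.f : ℤ) : K)]
    congr 2
    simp only [orientSign_eq, Prod.fst_mul, Perm.sign_mul]
    have h2 := units_mul_self K (boxSign (c.f ∘ h.1.symm))
    have h4 : c.f ∘ (g.1 * h.1).symm = (c.f ∘ h.1.symm) ∘ g.1.symm := rfl
    rw [h4]
    push_cast
    linear_combination - ((Perm.sign g.1 : ℤ) : K) * ((Perm.sign h.1 : ℤ) : K) *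
      ((boxSign c.f : ℤ) : K) * ((boxSign ((c.f ∘ h.1.symm) ∘ g.1.symm) : ℤ) : K) * h2

end Cell

/-! ### The parity-shifted dg properad of permutahedra cochains -/

section Generators

variable (K : Type u) [Field K]

/-- The dg S-bimodule of permutahedra cochains: `W(m, 0)` is the dual of the complex of oriented
cells of `P_{m-1}`, with the dual action and the dual differential, the cochains on the cells of
dimension `d` being of degree `d`; `W(m, n) = 0` for `n ≥ 1`. -/
noncomputable def cochains : DGSBimodule K where
  X m n := Module.Dual K (Cell m n →₀ K)
  deg m n d :=
    { carrier := {φ | ∀ c : Cell m n, (m : ℤ) - c.k ≠ d → φ (Finsupp.single c 1) = 0}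
      add_mem' := fun {φ ψ} hφ hψ c hc => by
        rw [LinearMap.add_apply, hφ c hc, hψ c hc, add_zero]
      zero_mem' := fun _ _ => rfl
      smul_mem' := fun r φ hφ c hc => by
        rw [LinearMap.smul_apply, hφ c hc, smul_zero] }
  isInternal m n := by
    let r : ℤ → (Cell m n →₀ K) →ₗ[K] (Cell m n →₀ K) := fun d =>
      Finsupp.linearCombination K fun c =>
        if (m : ℤ) - c.k = d then Finsupp.single c 1 else 0
    have hr : ∀ d c, r d (Finsupp.single c 1) =
        if (m : ℤ) - c.k = d then Finsupp.single c 1 else 0 := by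
      intro d c
      simp only [r, Finsupp.linearCombination_single, one_smul]
    refine isInternal_of_proj _ (fun d => (r d).dualMap) ?_ ?_ ?_
    · intro d φ hφ
      refine Finsupp.lhom_ext' fun c => LinearMap.ext_ring ?_
      change φ (r d (Finsupp.single c 1)) = φ (Finsupp.single c 1)
      rw [hr]
      split_ifs with h
      · rfl
      · rw [hφ c h, map_zero]
    · intro d e φ hφ hne
      refine Finsupp.lhom_ext' fun c => LinearMap.ext_ring ?_
      change φ (r d (Finsupp.single c 1)) = 0
      rw [hr]
      split_ifs with h
      · exact hφ c (h ▸ hne)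
      · rw [map_zero]
    · rw [eq_top_iff]
      intro φ _
      have : φ = ∑ d ∈ Finset.Icc (0 : ℤ) m, (r d).dualMap φ := by
        refine Finsupp.lhom_ext' fun c => LinearMap.ext_ring ?_
        change φ (Finsupp.single c 1) =
          (∑ d ∈ Finset.Icc (0 : ℤ) m, (r d).dualMap φ) (Finsupp.single c 1)
        rw [LinearMap.sum_apply]
        have hc := c.k_le
        rw [Finset.sum_eq_single ((m : ℤ) - c.k)]
        · change _ = φ (r _ (Finsupp.single c 1))
          rw [hr, if_pos rfl]
        · intro d _ hd
          change φ (r d (Finsupp.single c 1)) = 0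
          rw [hr, if_neg (Ne.symm hd), map_zero]
        · intro h
          exact absurd (Finset.mem_Icc.2 ⟨by omega, by omega⟩) h
      rw [this]
      refine Submodule.sum_mem _ fun d _ => Submodule.mem_iSup_of_mem d ?_
      intro c hc
      change φ (r d (Finsupp.single c 1)) = 0
      rw [hr, if_neg hc, map_zero]
  act m n := (Cell.rep K m n).dual
  act_mem := by
    intro m n g d φ hφ c hc
    change φ (Cell.relabelMap K n g⁻¹.1 (Finsupp.single c 1)) = 0
    rw [Cell.single_eq_bas, one_smul, Cell.relabelMap_bas, map_smul]
    have h := hφ (c.relabel g⁻¹.1) hc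
    rw [Cell.single_eq_bas, one_smul] at h
    exact smul_eq_zero_of_right _ h
  δ m n := (Cell.bdry K m n).dualMap
  δ_mem := by
    intro m n d φ hφ c hc
    change φ (Cell.bdry K m n (Finsupp.single c 1)) = 0
    rw [Cell.bdry, Finsupp.linearCombination_single, one_smul, Cell.boundary, map_sum]
    refine Finset.sum_eq_zero fun i _ => ?_
    rw [map_sum]
    refine Finset.sum_eq_zero fun g _ => ?_
    split_ifs with h
    · have := hφ ⟨c.k + 1, g, h.1, c.pos, c.hn⟩ (by push_cast; omega)
      rw [← mul_one ((splitSign i g : ℤ) : K), ← smul_eq_mul, ← Finsupp.smul_single, map_smul,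
        this, smul_zero]
    · exact map_zero φ
  δ_δ := by
    intro m n φ
    refine LinearMap.ext fun x => ?_
    change φ (Cell.bdry K m n (Cell.bdry K m n x)) = 0
    rw [Cell.bdry_bdry, map_zero]
  δ_act := by
    intro m n g φ
    refine LinearMap.ext fun x => ?_
    change φ (Cell.relabelMap K n g⁻¹.1 (Cell.bdry K m n x)) =
      φ (Cell.bdry K m n (Cell.relabelMap K n g⁻¹.1 x))
    rw [Cell.relabelMap_bdry]

variable {K} in
/-- The parity change on generators: `sgn_m ⊗ E(m, n) ⊗ sgn_n [m - n]`. -/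
noncomputable def DGSBimodule.parityShift (E : DGSBimodule K) : DGSBimodule K where
  X := E.X
  deg m n d := E.deg m n (d + ((m : ℤ) - n))
  isInternal m n := by
    have h := E.isInternal m n
    rw [DirectSum.isInternal_submodule_iff_iSupIndep_and_iSup_eq_top] at h ⊢
    exact ⟨h.1.comp (Equiv.addRight ((m : ℤ) - n)).injective,
      ((Equiv.addRight ((m : ℤ) - n)).iSup_comp (g := E.deg m n)).trans h.2⟩
  act m n :=
    { toFun := fun g => (((Perm.sign g.1 * Perm.sign g.2 : ℤˣ) : ℤ) : K) • E.act m n g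
      map_one' := by simp
      map_mul' := fun g h => by
        rw [map_mul, smul_mul_smul_comm, Prod.fst_mul, Prod.snd_mul, Perm.sign_mul, Perm.sign_mul]
        congr 1
        push_cast
        ring }
  act_mem := by
    intro m n g d x hx
    exact Submodule.smul_mem _ _ (E.act_mem g hx)
  δ := E.δ
  δ_mem := by
    intro m n d x hx
    have := E.δ_mem hx
    rwa [add_right_comm] at this
  δ_δ := E.δ_δ
  δ_act := by
    intro m n g x
    change E.δ m n ((((Perm.sign g.1 * Perm.sign g.2 : ℤˣ) : ℤ) : K) • E.act m n g x) =
      (((Perm.sign g.1 * Perm.sign g.2 : ℤˣ) : ℤ) : K) • E.act m n g (E.δ m n x)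
    rw [map_smul, E.δ_act]

/-- The dg S-bimodule of generators of the parity-shifted properad of permutahedra cochains. -/
noncomputable def generators : DGSBimodule K := (cochains K).parityShift

/-- The generator given by the ordered partition `c`: up to a sign, the cochain dual to the cell
`c`. The signs are such that the permutations of labels act without signs (`act_box`) and the
differential merges neighbouring blocks with the signs `(-1) ^ i` (`δ_box`). -/
noncomputable def box {m n : ℕ} (c : Cell m n) : (generators K).X m n :=
  (((boxSign c.f : ℤ) : K) • Finsupp.lapply c : (Cell m n →₀ K) →ₗ[K] K)

theorem act_box {m n : ℕ} (g : Perm (Fin m) × Perm (Fin n)) (c : Cell m n) :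
    (generators K).act m n g (box K c) = box K (c.relabel g.1) := by
  obtain ⟨σ, τ⟩ := g
  have hτ : Perm.sign τ = 1 := by
    have h := c.hn
    subst h
    rw [Subsingleton.elim τ 1, map_one]
  refine Finsupp.lhom_ext' fun c' => LinearMap.ext_ring ?_
  change (((Perm.sign σ * Perm.sign τ : ℤˣ) : ℤ) : K) * (((boxSign c.f : ℤ) : K) *
    (Cell.relabelMap K n σ⁻¹ (Finsupp.single c' 1)) c) =
    ((boxSign (c.f ∘ σ.symm) : ℤ) : K) * (Finsupp.single c' (1 : K)) (c.relabel σ)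
  rw [Cell.relabelMap, Finsupp.linearCombination_single, one_smul, hτ, mul_one]
  by_cases h : c' = c.relabel σ
  · subst h
    have h1 : (c.relabel σ).relabel σ⁻¹ = c := by
      have : ((c.f ∘ σ.symm) ∘ (σ⁻¹).symm) = c.f := by
        funext x
        exact congrArg c.f (σ.symm_apply_apply x)
      obtain ⟨k, f, h1, h2, h3⟩ := c
      simp only [Cell.relabel] at this ⊢
      simp only [this]
    have h2 : (c.f ∘ σ.symm) ∘ (σ⁻¹).symm = c.f := by
      funext x
      exact congrArg c.f (σ.symm_apply_apply x)
    rw [h1, Finsupp.single_eq_same, Finsupp.single_eq_same]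
    change _ * (_ * ((orientSign σ⁻¹ (c.f ∘ σ.symm) : ℤ) : K)) = _
    rw [orientSign_eq, h2, Perm.sign_inv]
    have e1 := Cell.units_mul_self K (Perm.sign σ)
    have e2 := Cell.units_mul_self K (boxSign c.f)
    push_cast
    linear_combination ((boxSign (c.f ∘ σ.symm) : ℤ) : K) * (e2 * ((Perm.sign σ : ℤ) : K) ^ 2 + e1)
  · have h1 : c'.relabel σ⁻¹ ≠ c := by
      rintro rfl
      refine h ?_
      have : ((c'.f ∘ (σ⁻¹).symm) ∘ σ.symm) = c'.f := by
        funext x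
        exact congrArg c'.f (σ.apply_symm_apply x)
      obtain ⟨k, f, h1, h2, h3⟩ := c'
      simp only [Cell.relabel] at this ⊢
      simp only [this]
    rw [Finsupp.single_eq_of_ne (Ne.symm h1), Finsupp.single_eq_of_ne (Ne.symm h)]
    simp

theorem δ_box {m n k : ℕ} (g : Fin m → Fin (k + 1)) (hg : Function.Surjective g) (hm : 0 < m)
    (hn : n = 0) :
    (generators K).δ m n (box K ⟨k + 1, g, hg, hm, hn⟩) = ∑ i : Fin k, (-1 : K) ^ (i : ℕ) •
      box K ⟨k, i.predAbove ∘ g, (Fin.predAbove_surjective i).comp hg, hm, hn⟩ := by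
  refine Finsupp.lhom_ext' fun c => LinearMap.ext_ring ?_
  let B : Fin k → ((Cell m n →₀ K) →ₗ[K] K) := fun i => (-1 : K) ^ (i : ℕ) •
    ((boxSign (i.predAbove ∘ g) : ℤ) : K) • Finsupp.lapply
      (⟨k, i.predAbove ∘ g, (Fin.predAbove_surjective i).comp hg, hm, hn⟩ : Cell m n)
  have hR : (∑ i : Fin k, B i) (Finsupp.single c 1) = ∑ i : Fin k, (-1 : K) ^ (i : ℕ) *
      (((boxSign (i.predAbove ∘ g) : ℤ) : K) * (Finsupp.single c (1 : K))
        ⟨k, i.predAbove ∘ g, (Fin.predAbove_surjective i).comp hg, hm, hn⟩) := by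
    rw [LinearMap.sum_apply]
    rfl
  refine Eq.trans ?_ hR.symm
  change ((boxSign g : ℤ) : K) * (Cell.bdry K m n (Finsupp.single c 1)) ⟨k + 1, g, hg, hm, hn⟩ = _
  rw [Cell.bdry, Finsupp.linearCombination_single, one_smul, Cell.boundary, Finsupp.finsetSum_apply]
  simp only [Finsupp.finsetSum_apply]
  clear hR
  obtain ⟨l, f, hf, h2, h3⟩ := c
  dsimp only
  by_cases hl : l = k
  · subst hl
    rw [Finset.mul_sum]
    refine Finset.sum_congr rfl fun i _ => ?_
    rw [Finset.sum_eq_single g]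
    · by_cases hi : i.predAbove ∘ g = f
      · subst hi
        rw [dif_pos ⟨hg, rfl⟩, Finsupp.single_eq_same, Finsupp.single_eq_same, boxSign_predAbove]
        have e1 := Cell.units_mul_self K (boxSign g)
        push_cast
        linear_combination (-1) ^ (i : ℕ) * ((boxSign (i.predAbove ∘ g) : ℤ) : K) * e1
      · rw [dif_neg (fun h => hi h.2), Finsupp.single_eq_of_ne]
        · simp
        · intro h
          simp only [Cell.mk.injEq, heq_eq_eq, true_and] at h
          exact hi h
    · intro g' _ hne
      split_ifs with h
      · rw [Finsupp.single_eq_of_ne]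
        intro h
        simp only [Cell.mk.injEq, heq_eq_eq, true_and] at h
        exact hne h.symm
      · rfl
    · intro h; exact absurd (Finset.mem_univ _) h
  · have e1 : ∀ i : Fin k, (Finsupp.single (⟨l, f, hf, h2, h3⟩ : Cell m n) (1 : K))
        ⟨k, i.predAbove ∘ g, (Fin.predAbove_surjective i).comp hg, hm, hn⟩ = 0 := by
      intro i
      rw [Finsupp.single_eq_of_ne]
      intro h
      simp only [Cell.mk.injEq] at h
      exact hl h.1.symm
    simp only [e1, mul_zero, Finset.sum_const_zero]
    refine mul_eq_zero_of_right _ (Finset.sum_eq_zero fun i _ => Finset.sum_eq_zero fun g' _ => ?_)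
    split_ifs with h
    · rw [Finsupp.single_eq_of_ne]
      intro h
      simp only [Cell.mk.injEq] at h
      exact hl (by omega)
    · rfl

/-- The ordered partition `({σ 1}, …, {σ m})`: a vertex of the permutahedron. -/
def vertex {m : ℕ} (hm : 0 < m) (σ : Perm (Fin m)) : Cell m 0 :=
  ⟨m, σ.symm, σ.symm.surjective, hm, rfl⟩

/-- The signed sum over all vertices of the permutahedron. -/
noncomputable def vertexSum {m : ℕ} (hm : 0 < m) : (generators K).X m 0 :=
  ∑ σ : Perm (Fin m), ((Perm.sign σ : ℤ) : K) • box K (vertex hm σ)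

/-- The S-bimodule spanned by one corolla with `m` skew-symmetric output legs and no input legs,
of degree `-m`, for every `m ≥ 1`: the sign representation of `S_m` in degree `-m`, placed in
arity `(m, 0)`. -/
noncomputable def skewCorollas : SBimodule K where
  X m n := {_u : Unit // n = 0 ∧ 0 < m} → K
  deg m _ d := if d = -(m : ℤ) then ⊤ else ⊥
  isInternal m n := by
    refine isInternal_of_proj _ (fun d => if d = -(m : ℤ) then LinearMap.id else 0) ?_ ?_ ?_
    · intro d x hx
      split_ifs at hx ⊢ with h
      · rfl
      · exact ((Submodule.mem_bot K).1 hx).symm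
    · intro d e x hx hne
      split_ifs at hx ⊢ with h1 h2 h2
      · exact absurd (h1.trans h2.symm) hne
      all_goals first | rfl | exact (Submodule.mem_bot K).1 hx
    · rw [eq_top_iff]
      exact le_iSup_of_le (-(m : ℤ)) (by simp)
  act m n :=
    { toFun := fun g => ((Perm.sign g.1 : ℤ) : K) • LinearMap.id
      map_one' := by simp; rfl
      map_mul' := fun g h => by
        ext x
        simp
        ring }
  act_mem := by
    intro m n g d x hx
    exact Submodule.smul_mem _ _ hx

/-- The corolla with `m` skew-symmetric legs. -/
def corollaGen {m : ℕ} (_hm : 0 < m) : (skewCorollas K).X m 0 := fun _ => 1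

end Generators

end Properadic

/-! The generators live only in arities without inputs. A connected graph with two or more vertices
has an internal edge, hence a vertex with an input, and a decoration of that vertex is zero. So only
corollas have nonzero compositions, and these merely relabel legs. A dg S-bimodule without inputs is
therefore already a dg properad (`DGSBimodule.single`), and it is free on itself. By uniqueness
every free properad on such generators consists of its generators (`Properad.IsFree.bijective`). The
theorem thus reduces to computing the cohomology of `generators K` arity by arity.

In the basis `box` the differential merges neighbouring blocks with alternating signs. Reading a
cell as the word of its blocks identifies the generators in arity `(m, 0)`, `m ≥ 1`, with the part
of the reduced bar complex of the free commutative monoid on `Fin m` where every element occurs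
exactly once (`toWords_δ`).

In each multidegree the cohomology of this bar complex is at most one-dimensional
(`Bar.exists_generator`). Indeed, for a letter `a` of the multidegree, find the first block that
contains `a`, split `a` off and shuffle it into the rest of the word. This is a homotopy between the
identity and "drop a leading `{a}`, then shuffle `{a}` back in" (`Bar.d_homotopy`). Since the signed
shuffle product with `{a}` anticommutes with the differential, induction on the multidegree applies.

It remains to see that the signed sum of vertices spans this cohomology. It is a cocycle because
merging two neighbouring blocks forgets their order, so terms cancel in pairs (`δ_skewCocycle`). It
is not a coboundary because the differential lowers the number of blocks, while vertices have the
largest possible number (`skewCocycle_ne_δ`). The symmetric group acts on it by the sign. The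
resulting map from the skew corollas to cohomology is bijective (`skewHom_bijective`), and a
bijection onto a properad without inputs exhibits it as free (`Properad.isFree_of_bijective`). -/

namespace Properadic

open Equiv

/-! ### The bar complex of a free commutative monoid -/

namespace Bar

variable {α : Type*} (K : Type u) [Field K]

/-- The free module on words of multisets. -/
abbrev Words (α : Type*) (K : Type u) [Field K] := List (Multiset α) →₀ K

variable {K}

/-- Putting the letter `I` in front of a word. -/
noncomputable def cons (I : Multiset α) : Words α K →ₗ[K] Words α K :=
  Finsupp.lmapDomain K K (List.cons I)

variable (K) in
/-- The word `I :: l` with `I` added to the first letter of `l`. -/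
noncomputable def mergeWord (I : Multiset α) : List (Multiset α) → Words α K
  | [] => 0
  | J :: l => Finsupp.single ((I + J) :: l) 1

/-- Adding `I` to the first letter of a word. -/
noncomputable def merge (I : Multiset α) : Words α K →ₗ[K] Words α K :=
  Finsupp.linearCombination K (mergeWord K I)

variable (K) in
/-- The bar differential of a word. -/
noncomputable def dWord : List (Multiset α) → Words α K
  | [] => 0
  | I :: l => mergeWord K I l - cons I (dWord l)

/-- The bar differential. -/
noncomputable def d : Words α K →ₗ[K] Words α K :=
  Finsupp.linearCombination K (dWord K)

variable (K) in
/-- The signed shuffle of the letter `{a}` with a word. -/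
noncomputable def shuffleWord (a : α) : List (Multiset α) → Words α K
  | [] => Finsupp.single [{a}] 1
  | I :: l => Finsupp.single ({a} :: I :: l) 1 - cons I (shuffleWord a l)

/-- The signed shuffle product with the letter `{a}`. -/
noncomputable def shuffle (a : α) : Words α K →ₗ[K] Words α K :=
  Finsupp.linearCombination K (shuffleWord K a)

@[simp] theorem cons_single (I : Multiset α) (l : List (Multiset α)) (r : K) :
    cons I (Finsupp.single l r) = Finsupp.single (I :: l) r := Finsupp.mapDomain_single

@[simp] theorem merge_single (I : Multiset α) (l : List (Multiset α)) :
    merge I (Finsupp.single l (1 : K)) = mergeWord K I l := by simp [merge]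

@[simp] theorem d_single (l : List (Multiset α)) :
    d (Finsupp.single l (1 : K)) = dWord K l := by simp [d]

@[simp] theorem shuffle_single (a : α) (l : List (Multiset α)) :
    shuffle a (Finsupp.single l (1 : K)) = shuffleWord K a l := by simp [shuffle]

theorem hom_ext {f g : Words α K →ₗ[K] Words α K}
    (h : ∀ l, f (Finsupp.single l 1) = g (Finsupp.single l 1)) (x : Words α K) : f x = g x :=
  LinearMap.congr_fun (Finsupp.lhom_ext' fun l => LinearMap.ext_ring (h l)) x

/-- This and the next two identities extend the recursive definitions from words to linear
combinations, so that later computations become algebra with the operators `cons`, `merge`, `d` and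
`shuffle`. -/
theorem merge_cons (I J : Multiset α) (x : Words α K) : merge I (cons J x) = cons (I + J) x :=
  hom_ext (f := merge I ∘ₗ cons J) (fun l => by simp [mergeWord]) x

theorem d_cons (I : Multiset α) (x : Words α K) : d (cons I x) = merge I x - cons I (d x) :=
  hom_ext (f := d ∘ₗ cons I) (g := merge I - cons I ∘ₗ d) (fun l => by simp [dWord]) x

theorem shuffle_cons (a : α) (I : Multiset α) (x : Words α K) :
    shuffle a (cons I x) = cons {a} (cons I x) - cons I (shuffle a x) :=
  hom_ext (f := shuffle a ∘ₗ cons I) (g := cons {a} ∘ₗ cons I - cons I ∘ₗ shuffle a)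
    (fun l => by simp [shuffleWord]) x

/-- The letter `{a}` is a cycle, so the shuffle product with it anticommutes with `d`. -/
theorem d_shuffle (a : α) (x : Words α K) : d (shuffle a x) = - shuffle a (d x) := by
  refine hom_ext (f := d ∘ₗ shuffle a) (g := - (shuffle a ∘ₗ d (K := K))) (fun l => ?_) x
  simp only [LinearMap.comp_apply, LinearMap.neg_apply]
  induction l with
  | nil => simp [shuffleWord, dWord, mergeWord]
  | cons I l ih =>
    rw [← cons_single, shuffle_cons]
    simp only [map_sub, d_cons, ih, merge_cons, map_neg, shuffle_cons]
    -- Commutativity of the monoid enters here: merging `{a}` with `I` from the left and from the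
    -- right gives the same letter, with opposite signs.
    cases l with
    | nil => simp [mergeWord, shuffleWord, dWord, add_comm]
    | cons J l =>
      rw [← cons_single, merge_cons, shuffle_cons, shuffle_cons, map_sub, merge_cons, merge_cons,
        add_comm {a} I]
      abel

variable (K) in
/-- The span of the words of nonempty letters with sum `S`. -/
noncomputable def validSpan (S : Multiset α) : Submodule K (Words α K) :=
  Submodule.span K ((fun l => Finsupp.single l 1) '' {l | 0 ∉ l ∧ l.sum = S})

theorem validSpan_le {S : Multiset α} {N : Submodule K (Words α K)}
    (h : ∀ l, 0 ∉ l → l.sum = S → Finsupp.single l 1 ∈ N) : validSpan K S ≤ N := by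
  rw [validSpan, Submodule.span_le]
  rintro _ ⟨l, ⟨h0, hS⟩, rfl⟩
  exact h l h0 hS

theorem single_mem {S : Multiset α} {l : List (Multiset α)} (h0 : 0 ∉ l) (hS : l.sum = S) :
    Finsupp.single l 1 ∈ validSpan K S := Submodule.subset_span ⟨l, ⟨h0, hS⟩, rfl⟩

theorem cons_mem {I S : Multiset α} (hI : I ≠ 0) {x : Words α K} (hx : x ∈ validSpan K S) :
    cons I x ∈ validSpan K (I + S) := by
  refine validSpan_le (N := (validSpan K (I + S)).comap (cons I)) (fun l h0 hS => ?_) hx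
  rw [Submodule.mem_comap, cons_single]
  exact single_mem (by simp [h0, Ne.symm hI]) (by simp [hS])

theorem shuffleWord_mem (a : α) (l : List (Multiset α)) (h0 : 0 ∉ l) :
    shuffleWord K a l ∈ validSpan K ({a} + l.sum) := by
  induction l with
  | nil => exact single_mem (by simp) (by simp)
  | cons I l ih =>
    rw [List.mem_cons, not_or] at h0
    refine Submodule.sub_mem _ (single_mem ?_ (by simp)) ?_
    · simp [h0.2, h0.1]
    · rw [List.sum_cons, add_left_comm]
      exact cons_mem (Ne.symm h0.1) (ih h0.2)

theorem shuffle_mem (a : α) {S : Multiset α} {x : Words α K} (hx : x ∈ validSpan K S) :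
    shuffle a x ∈ validSpan K (a ::ₘ S) := by
  refine validSpan_le (N := (validSpan K (a ::ₘ S)).comap (shuffle a)) (fun l h0 hS => ?_) hx
  rw [Submodule.mem_comap, shuffle_single, ← Multiset.singleton_add, ← hS]
  exact shuffleWord_mem a l h0

/-! ### Contraction by splitting off one letter -/

variable [DecidableEq α]

variable (K) in
/-- Splitting `a` off its letter and shuffling it into the rest of the word. -/
noncomputable def homotopyWord (a : α) : List (Multiset α) → Words α K
  | [] => 0
  | I :: l => if a ∈ I then if I = {a} then 0 else cons (I.erase a) (shuffleWord K a l)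
      else - cons I (homotopyWord a l)

/-- The contracting homotopy. -/
noncomputable def homotopy (a : α) : Words α K →ₗ[K] Words α K :=
  Finsupp.linearCombination K (homotopyWord K a)

variable (K) in
/-- Removing a first letter `{a}`; words with another first letter go to zero. -/
noncomputable def dropWord (a : α) : List (Multiset α) → Words α K
  | [] => 0
  | I :: l => if I = {a} then Finsupp.single l 1 else 0

/-- The linear extension of `dropWord`. -/
noncomputable def drop (a : α) : Words α K →ₗ[K] Words α K :=
  Finsupp.linearCombination K (dropWord K a)

@[simp] theorem homotopy_single (a : α) (l : List (Multiset α)) :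
    homotopy a (Finsupp.single l (1 : K)) = homotopyWord K a l := by simp [homotopy]

@[simp] theorem drop_single (a : α) (l : List (Multiset α)) :
    drop a (Finsupp.single l (1 : K)) = dropWord K a l := by simp [drop]

theorem homotopy_cons_of_notMem {a : α} {I : Multiset α} (h : a ∉ I) (x : Words α K) :
    homotopy a (cons I x) = - cons I (homotopy a x) :=
  hom_ext (f := homotopy a ∘ₗ cons I) (g := - (cons I ∘ₗ homotopy (K := K) a))
    (fun l => by simp [homotopyWord, h]) x

theorem homotopy_cons_of_mem {a : α} {I : Multiset α} (h : a ∈ I) (hI : I ≠ {a})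
    (x : Words α K) : homotopy a (cons I x) = cons (I.erase a) (shuffle a x) :=
  hom_ext (f := homotopy a ∘ₗ cons I) (g := cons (I.erase a) ∘ₗ shuffle a)
    (fun l => by simp [homotopyWord, h, hI]) x

/-- As `J` is nonempty, the letter is not the singleton `{a}`, on which the homotopy vanishes.
Writing the letter as a sum makes splitting visibly inverse to merging. -/
theorem homotopy_cons_add {a : α} {J : Multiset α} (h : J ≠ 0) (x : Words α K) :
    homotopy a (cons ({a} + J) x) = cons J (shuffle a x) := by
  have h1 : a ∈ ({a} + J : Multiset α) := by simp
  have h2 : ({a} + J : Multiset α).erase a = J := by simp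
  rw [homotopy_cons_of_mem h1 (fun h' => h (add_eq_left.1 h')), h2]

theorem homotopy_cons_singleton (a : α) (x : Words α K) : homotopy a (cons {a} x) = 0 :=
  hom_ext (f := homotopy a ∘ₗ cons {a}) (g := 0) (fun l => by simp [homotopyWord]) x

theorem drop_cons (a : α) (I : Multiset α) (x : Words α K) :
    drop a (cons I x) = if I = {a} then x else 0 := by
  refine hom_ext (f := drop a ∘ₗ cons I) (g := if I = {a} then LinearMap.id else 0)
    (fun l => ?_) x |>.trans ?_
  · simp only [LinearMap.comp_apply, cons_single, drop_single, dropWord]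
    split_ifs <;> rfl
  · split_ifs <;> rfl

/-- The homotopy contracts the complex onto the words that begin with `{a}`. -/
theorem d_homotopy (a : α) (l : List (Multiset α)) (h0 : 0 ∉ l) (ha : a ∈ l.sum) :
    d (homotopyWord K a l) + homotopy a (dWord K l) =
      Finsupp.single l 1 - shuffle a (dropWord K a l) := by
  induction l with
  | nil => simp at ha
  | cons I l ih =>
    rw [List.mem_cons, not_or] at h0
    rw [← homotopy_single, ← d_single, ← drop_single, ← cons_single, d_cons, map_sub, drop_cons]
    by_cases haI : a ∈ I
    · obtain ⟨J, rfl⟩ := Multiset.exists_cons_of_mem haI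
      rw [← Multiset.singleton_add]
      by_cases hJ : J = 0
      · subst hJ
        rw [add_zero, homotopy_cons_singleton, homotopy_cons_singleton, if_pos rfl]
        -- The word begins with `{a}`. Only the term merging `{a}` into the next letter survives the
        -- homotopy, and splitting `{a}` off again gives the shuffles in which `{a}` is not in
        -- front.
        cases l with
        | nil => simp [mergeWord, shuffleWord]
        | cons J l =>
          have hJ : J ≠ 0 := fun h => h0.2 (by simp [h])
          rw [← cons_single, merge_cons, homotopy_cons_add hJ, shuffle_cons]
          simp
      -- The first letter is `{a} + J` with `J` nonempty. Merging the shuffled `{a}` back into `J`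
      -- restores the word; the other terms cancel in pairs by `d_shuffle`.
      · rw [homotopy_cons_add hJ, homotopy_cons_add hJ, d_cons, d_shuffle,
          if_neg (fun h => hJ (add_eq_left.1 h)), map_zero]
        cases l with
        | nil => simp [mergeWord, shuffleWord, dWord, add_comm]
        | cons I l =>
          rw [← cons_single, merge_cons, shuffle_cons, map_sub, merge_cons, merge_cons, add_assoc,
            homotopy_cons_add (by simp [hJ]), map_neg, add_comm {a} J]
          abel
    · have hI : I ≠ {a} := by rintro rfl; simp at haI
      have hal : a ∈ l.sum := by simpa [haI] using ha
      have ih := ih h0.2 hal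
      rw [homotopy_cons_of_notMem haI, homotopy_cons_of_notMem haI, map_neg, d_cons, if_neg hI,
        map_zero, homotopy_single, d_single]
      have ih' := congrArg (cons I) (eq_sub_of_add_eq ih)
      simp only [map_sub] at ih'
      rw [ih']
      -- The induction hypothesis leaves only the terms that merge `I` with the next letter `J`. If
      -- `J = {a}`, merging and splitting off `a` cancels the shuffle correction of the hypothesis;
      -- otherwise the homotopy commutes with the merging.
      cases l with
      | nil => simp at hal
      | cons J l =>
        rw [← homotopy_single, ← drop_single, ← cons_single, merge_cons, drop_cons]
        by_cases haJ : a ∈ J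
        · obtain ⟨J, rfl⟩ := Multiset.exists_cons_of_mem haJ
          have hIJ : I + J ≠ 0 := fun h => h0.1 (by simp at h; exact h.1.symm)
          rw [← Multiset.singleton_add, add_left_comm, homotopy_cons_add hIJ]
          by_cases hJ : J = 0
          · subst hJ
            rw [add_zero, add_zero, homotopy_cons_singleton, if_pos rfl]
            simp
          · rw [homotopy_cons_add hJ, if_neg (fun h => hJ (add_eq_left.1 h)), merge_cons]
            simp
            abel
        · rw [homotopy_cons_of_notMem haJ, homotopy_cons_of_notMem (by simp [haI, haJ]), if_neg
            (by rintro rfl; simp at haJ), map_neg, merge_cons]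
          simp

/-- Merging two nonempty letters gives a letter with at least two elements, never `{a}`. Only the
differential of the tail survives, with the sign of the recursion for `dWord`. -/
theorem drop_dWord (a : α) (l : List (Multiset α)) (h0 : 0 ∉ l) :
    drop a (dWord K l) = - d (dropWord K a l) := by
  cases l with
  | nil => simp [dWord, dropWord]
  | cons I l =>
    rw [List.mem_cons, not_or] at h0
    rw [dWord, map_sub, drop_cons, dropWord]
    have : drop a (mergeWord K I l) = 0 := by
      cases l with
      | nil => simp [mergeWord]
      | cons J l =>
        have hJ : J ≠ 0 := fun h => h0.2 (by simp [h])
        rw [mergeWord, drop_single, dropWord, if_neg]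
        intro h
        have h1 := congrArg Multiset.card h
        have h2 := Multiset.card_pos.2 hJ
        have h3 := Multiset.card_pos.2 (Ne.symm h0.1)
        rw [Multiset.card_add, Multiset.card_singleton] at h1
        omega
    rw [this]
    split_ifs <;> simp

/-- The homotopy stays in the reduced complex: sending a letter equal to `{a}` to zero prevents
`I.erase a` from being empty. -/
theorem homotopyWord_mem (a : α) (l : List (Multiset α)) (h0 : 0 ∉ l) :
    homotopyWord K a l ∈ validSpan K l.sum := by
  induction l with
  | nil => exact Submodule.zero_mem _
  | cons I l ih =>
    rw [List.mem_cons, not_or] at h0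
    rw [homotopyWord, List.sum_cons]
    split_ifs with h1 h2
    · exact Submodule.zero_mem _
    · obtain ⟨J, rfl⟩ := Multiset.exists_cons_of_mem h1
      rw [Multiset.erase_cons_head, ← Multiset.singleton_add, add_comm {a} J, add_assoc]
      refine cons_mem ?_ (shuffleWord_mem a l h0.2)
      rintro rfl
      exact h2 rfl
    · exact Submodule.neg_mem _ (cons_mem (Ne.symm h0.1) (ih h0.2))

theorem homotopy_mem (a : α) {S : Multiset α} {x : Words α K} (hx : x ∈ validSpan K S) :
    homotopy a x ∈ validSpan K S := by
  refine validSpan_le (N := (validSpan K S).comap (homotopy a)) (fun l h0 hS => ?_) hx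
  rw [Submodule.mem_comap, homotopy_single, ← hS]
  exact homotopyWord_mem a l h0

theorem drop_mem (a : α) {S : Multiset α} {x : Words α K} (hx : x ∈ validSpan K (a ::ₘ S)) :
    drop a x ∈ validSpan K S := by
  refine validSpan_le (N := (validSpan K S).comap (drop a)) (fun l h0 hS => ?_) hx
  rw [Submodule.mem_comap, drop_single]
  cases l with
  | nil => exact Submodule.zero_mem _
  | cons I l =>
    rw [dropWord]
    split_ifs with h
    · subst h
      exact single_mem (fun h => h0 (List.mem_cons_of_mem _ h)) (by simpa using hS)
    · exact Submodule.zero_mem _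

/-- The part of the bar complex of a given multidegree has at most one cohomology class up to
multiples. -/
theorem exists_generator (S : Multiset α) : ∃ w : Words α K, ∀ x ∈ validSpan K S, d x = 0 →
    ∃ (c : K), ∃ y ∈ validSpan K S, x = c • w + d y := by
  induction S using Multiset.induction_on with
  | empty =>
    refine ⟨Finsupp.single [] 1, fun x hx _ => ?_⟩
    have : x ∈ Submodule.span K {Finsupp.single ([] : List (Multiset α)) (1 : K)} := by
      refine validSpan_le (fun l h0 hS => ?_) hx
      have : l = [] := by
        cases l with
        | nil => rfl
        | cons I l => simp at h0 hS; exact absurd hS.1.symm h0.1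
      subst this
      exact Submodule.mem_span_singleton_self _
    obtain ⟨c, rfl⟩ := Submodule.mem_span_singleton.1 this
    exact ⟨c, 0, Submodule.zero_mem _, by simp⟩
  | cons a S ih =>
    obtain ⟨w, hw⟩ := ih
    -- The generator is an iterated shuffle product of singletons. It need not be shown to be a
    -- cycle, nor to be nonzero.
    refine ⟨shuffle a w, fun x hx hdx => ?_⟩
    have h1 : d (homotopy a x) + homotopy a (d x) = x - shuffle a (drop a x) := by
      have := validSpan_le (S := a ::ₘ S) (N := LinearMap.eqLocus
        (d ∘ₗ homotopy a + homotopy a ∘ₗ d) (LinearMap.id - shuffle a ∘ₗ drop a))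
        (fun l h0 hS => by
          have := d_homotopy (K := K) a l h0 (by simp [hS])
          simpa [LinearMap.mem_eqLocus] using this) hx
      simpa [LinearMap.mem_eqLocus] using this
    have h2 : drop a (d x) = - d (drop a x) := by
      have := validSpan_le (S := a ::ₘ S) (N := LinearMap.eqLocus (drop a ∘ₗ d)
        (- (d ∘ₗ drop (K := K) a))) (fun l h0 hS => by
          have := drop_dWord (K := K) a l h0
          simpa [LinearMap.mem_eqLocus] using this) hx
      simpa [LinearMap.mem_eqLocus] using this
    rw [hdx, map_zero] at h1 h2
    obtain ⟨c, y, hy, hxy⟩ := hw _ (drop_mem a hx) (neg_eq_zero.1 h2.symm)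
    -- Substituting `drop a x = c • w + d y` into the homotopy formula leaves `shuffle a (d y)`,
    -- which is `- d (shuffle a y)`.
    refine ⟨c, homotopy a x - shuffle a y,
      Submodule.sub_mem _ (homotopy_mem a hx) (shuffle_mem a hy), ?_⟩
    rw [hxy, map_add, map_smul] at h1
    rw [map_sub, d_shuffle, ← sub_eq_zero]
    rw [add_zero] at h1
    rw [h1]
    abel
end Bar

/-! ### The cochains of the permutahedra as a part of the bar complex -/

namespace Bar

/-- Unrolling the recursion, a merge at position `i` passes `i` letters, and each of them
contributes a factor `-1`. -/
theorem dWord_ofFn {α : Type*} (K : Type u) [Field K] {k : ℕ} (b : Fin (k + 1) → Multiset α) :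
    dWord K (List.ofFn b) = ∑ i : Fin k, (-1 : K) ^ (i : ℕ) •
      Finsupp.single (List.ofFn (i.castSucc.contractNth (· + ·) b)) 1 := by
  induction k with
  | zero => simp [dWord, mergeWord]
  | succ k ih =>
    have h0 : List.ofFn ((0 : Fin (k + 1)).castSucc.contractNth (· + ·) b) =
        (b 0 + b 1) :: List.ofFn (fun j : Fin k => b j.succ.succ) := by
      rw [List.ofFn_succ]
      congr 1
    have h1 : ∀ i : Fin k, List.ofFn (i.succ.castSucc.contractNth (· + ·) b) =
        b 0 :: List.ofFn (i.castSucc.contractNth (· + ·) fun j => b j.succ) := by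
      intro i
      rw [List.ofFn_succ]
      congr 2
      funext j
      simp only [Fin.contractNth, Fin.val_succ, Fin.val_castSucc, Fin.succ_castSucc,
        add_lt_add_iff_right, add_left_inj]
    rw [List.ofFn_succ, dWord, ih, Fin.sum_univ_succ, h0]
    simp only [h1]
    rw [sub_eq_add_neg, map_sum, ← Finset.sum_neg_distrib]
    congr 1
    · rw [List.ofFn_succ, mergeWord]
      simp
    · refine Finset.sum_congr rfl fun i _ => ?_
      rw [map_smul, cons_single, Fin.val_succ, pow_succ, mul_neg_one, neg_smul]

end Bar

/-! ### Ordered partitions as words of blocks -/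

section Block

variable {m k : ℕ}

/-- The block `f⁻¹ {j}`. -/
def block (f : Fin m → Fin k) (j : Fin k) : Multiset (Fin m) :=
  (Finset.univ.filter fun x => f x = j).val

theorem count_block (f : Fin m → Fin k) (j : Fin k) (x : Fin m) :
    (block f j).count x = if f x = j then 1 else 0 := by
  rw [block, Multiset.count_eq_of_nodup (Finset.nodup _)]
  simp

/-- Identifying the indices `i` and `i + 1` unites the two blocks, and a union of disjoint blocks is
a sum of multisets. This matches the faces of permutahedra with the terms of the bar differential.
-/
theorem block_predAbove (i : Fin k) (g : Fin m → Fin (k + 1)) :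
    block (i.predAbove ∘ g) = i.castSucc.contractNth (· + ·) (block g) := by
  funext j
  refine Multiset.ext.2 fun x => ?_
  rw [count_block, Fin.contractNth]
  simp only [Fin.val_castSucc]
  have h := predAbove_val i (g x)
  split_ifs with h1 h2 h3 h4 h5 <;>
    simp only [Multiset.count_add, count_block, Function.comp_apply, Fin.ext_iff, Fin.val_succ,
      Fin.val_castSucc, h] at * <;>
    split_ifs at * <;> omega

end Block

namespace Cell

variable {m n : ℕ}

/-- The word of the blocks of a cell. -/
def word (c : Cell m n) : List (Multiset (Fin m)) := List.ofFn (block c.f)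

/-- The length of the word gives the number of blocks, and `f x` is the only index whose block
contains `x`. -/
theorem word_injective : Function.Injective (word : Cell m n → List (Multiset (Fin m))) := by
  rintro ⟨k, f, h1, h2, h3⟩ ⟨k', f', h1', h2', h3'⟩ h
  have hk := congrArg List.length h
  simp only [word, List.length_ofFn] at hk
  subst hk
  have h4 := List.ofFn_injective h
  have : f = f' := by
    funext x
    have h5 := congrArg (Multiset.count x) (congrFun h4 (f x))
    simp only [count_block, if_true] at h5
    split_ifs at h5 with h6
    exact h6.symm
  subst this
  rfl

theorem word_zero_notMem (c : Cell m n) : 0 ∉ c.word := by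
  rw [word, List.mem_ofFn]
  rintro ⟨j, hj⟩
  obtain ⟨x, hx⟩ := c.surj j
  have := count_block c.f j x
  rw [hj] at this
  simp [hx] at this

theorem word_sum (c : Cell m n) : c.word.sum = Finset.univ.val := by
  rw [word, List.sum_ofFn]
  refine Multiset.ext.2 fun x => ?_
  rw [Multiset.count_sum']
  simp [count_block]

/-- The multiplicities of each `x` in the letters add up to one, so exactly one letter contains `x`,
and it contains `x` once. Its index is `f x`; nonempty letters make `f` surjective. -/
theorem exists_word (hm : 0 < m) (hn : n = 0) (l : List (Multiset (Fin m))) (h0 : 0 ∉ l)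
    (hl : l.sum = Finset.univ.val) : ∃ c : Cell m n, c.word = l := by
  have h1 : ∀ x, ∑ j : Fin l.length, (l.get j).count x = 1 := by
    intro x
    rw [← Multiset.count_sum', ← List.sum_ofFn, List.ofFn_get, hl]
    simp
  have h2 : ∀ x, ∃ j, ∀ i, (l.get i).count x = if j = i then 1 else 0 := by
    intro x
    have : ∃ j, (l.get j).count x ≠ 0 := by
      by_contra! h
      have := h1 x
      rw [Finset.sum_eq_zero fun j _ => h j] at this
      exact zero_ne_one this
    obtain ⟨j, hj⟩ := this
    refine ⟨j, fun i => ?_⟩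
    have h3 := h1 x
    rw [← Finset.add_sum_erase _ _ (Finset.mem_univ j)] at h3
    split_ifs with h
    · subst h; omega
    · have h4 : ∑ i ∈ Finset.univ.erase j, (l.get i).count x = 0 := by omega
      rw [Finset.sum_eq_zero_iff] at h4
      exact h4 i (by simp [Ne.symm h])
  choose f hf using h2
  have hs : Function.Surjective f := by
    intro j
    have : l.get j ≠ 0 := fun h => h0 (h ▸ List.get_mem l j)
    obtain ⟨x, hx⟩ := Multiset.exists_mem_of_ne_zero this
    refine ⟨x, ?_⟩
    by_contra h
    have := hf x j
    rw [if_neg h] at this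
    exact (Multiset.count_pos.2 hx).ne' this
  have hb : block f = l.get := by
    funext j
    refine Multiset.ext.2 fun x => ?_
    rw [count_block, hf]
  exact ⟨⟨l.length, f, hs, hm, hn⟩, (congrArg List.ofFn hb).trans (List.ofFn_get l)⟩

instance : Finite (Cell m n) := by
  refine Finite.of_injective
    (fun c : Cell m n => (⟨⟨c.k, Nat.lt_succ_of_le c.k_le⟩, c.f⟩ : Σ k : Fin (m + 1), Fin m → Fin k))
    ?_
  rintro ⟨k, f, h1, h2, h3⟩ ⟨k', f', h1', h2', h3'⟩ h
  simp only [Sigma.mk.injEq, Fin.mk.injEq] at h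
  obtain ⟨rfl, h⟩ := h
  obtain rfl := eq_of_heq h
  rfl

noncomputable instance : Fintype (Cell m n) := Fintype.ofFinite _

end Cell

/-! ### Cochains in the basis of boxes, and their embedding into words -/

section Transfer

variable (K : Type u) [Field K] {m n : ℕ}

/-- The coefficient of `box c` in a cochain. -/
noncomputable def coeff (c : Cell m n) : (generators K).X m n →ₗ[K] K :=
  show Module.Dual K (Cell m n →₀ K) →ₗ[K] K from
    ((boxSign c.f : ℤ) : K) • Module.Dual.eval K (Cell m n →₀ K) (Finsupp.single c 1)

theorem coeff_box_self (c : Cell m n) : coeff K c (box K c) = 1 := by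
  change ((boxSign c.f : ℤ) : K) * (((boxSign c.f : ℤ) : K) * Finsupp.single c (1 : K) c) = 1
  rw [Finsupp.single_eq_same, mul_one, Cell.units_mul_self]

theorem coeff_box_of_ne {c c' : Cell m n} (h : c ≠ c') : coeff K c (box K c') = 0 := by
  change ((boxSign c.f : ℤ) : K) * (((boxSign c'.f : ℤ) : K) * Finsupp.single c (1 : K) c') = 0
  rw [Finsupp.single_eq_of_ne (Ne.symm h), mul_zero, mul_zero]

/-- A cochain is determined by its values on cells, and the coefficients are these values up to
invertible signs. -/
theorem sum_coeff_box (φ : (generators K).X m n) : ∑ c, coeff K c φ • box K c = φ := by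
  have key : ∀ φ : (generators K).X m n, (∀ c, coeff K c φ = 0) → φ = 0 := by
    intro φ h
    refine Finsupp.lhom_ext' fun c => LinearMap.ext_ring ?_
    have h1 : ((boxSign c.f : ℤ) : K) *
      (show Module.Dual K (Cell m n →₀ K) from φ) (Finsupp.single c 1) = 0 := h c
    refine (mul_eq_zero.1 h1).resolve_left fun h2 => ?_
    have := Cell.units_mul_self K (boxSign c.f)
    rw [h2, zero_mul] at this
    exact zero_ne_one this
  refine sub_eq_zero.1 (key _ fun c => ?_)
  rw [map_sub, map_sum, Finset.sum_eq_single c]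
  · rw [map_smul, coeff_box_self, smul_eq_mul, mul_one, sub_self]
  · intro c' _ h
    rw [map_smul, coeff_box_of_ne K (Ne.symm h), smul_zero]
  · intro h
    exact absurd (Finset.mem_univ _) h

theorem generators_ext {M : Type*} [AddCommGroup M] [Module K M]
    {f g : (generators K).X m n →ₗ[K] M} (h : ∀ c, f (box K c) = g (box K c)) : f = g := by
  refine LinearMap.ext fun φ => ?_
  rw [← sum_coeff_box K φ]
  simp only [map_sum, map_smul, h]

/-- The embedding of the generators into the bar complex. -/
noncomputable def toWords : (generators K).X m n →ₗ[K] Bar.Words (Fin m) K :=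
  ∑ c : Cell m n, Finsupp.lsingle c.word ∘ₗ coeff K c

theorem toWords_box (c : Cell m n) : toWords K (box K c) = Finsupp.single c.word 1 := by
  rw [toWords, LinearMap.sum_apply, Finset.sum_eq_single c]
  · rw [LinearMap.comp_apply, coeff_box_self, Finsupp.lsingle_apply]
  · intro c' _ h
    rw [LinearMap.comp_apply, coeff_box_of_ne K h, map_zero]
  · intro h
    exact absurd (Finset.mem_univ _) h

theorem toWords_apply (φ : (generators K).X m n) (c : Cell m n) :
    toWords K φ c.word = coeff K c φ := by
  rw [toWords, LinearMap.sum_apply, Finsupp.finsetSum_apply, Finset.sum_eq_single c]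
  · exact Finsupp.single_eq_same
  · intro c' _ h
    exact Finsupp.single_eq_of_ne fun h' => h (Cell.word_injective h').symm
  · intro h
    exact absurd (Finset.mem_univ _) h

theorem toWords_injective : Function.Injective (toWords K (m := m) (n := n)) := by
  refine (injective_iff_map_eq_zero _).2 fun φ h => ?_
  rw [← sum_coeff_box K φ]
  refine Finset.sum_eq_zero fun c _ => ?_
  rw [← toWords_apply, h, Finsupp.zero_apply, zero_smul]

theorem toWords_mem (φ : (generators K).X m n) :
    toWords K φ ∈ Bar.validSpan K (Finset.univ : Finset (Fin m)).val := by
  rw [← sum_coeff_box K φ, map_sum]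
  refine Submodule.sum_mem _ fun c _ => ?_
  rw [map_smul, toWords_box]
  exact Submodule.smul_mem _ _ (Bar.single_mem c.word_zero_notMem c.word_sum)

/-- Every word of nonempty letters using each element once comes from a cell. This brings the
primitives found in the bar complex back to the generators. -/
theorem exists_toWords (hm : 0 < m) (hn : n = 0) (y : Bar.Words (Fin m) K)
    (hy : y ∈ Bar.validSpan K (Finset.univ : Finset (Fin m)).val) :
    ∃ φ : (generators K).X m n, toWords K φ = y := by
  refine Bar.validSpan_le (N := LinearMap.range (toWords K (m := m) (n := n)))
    (fun l h0 hl => ?_) hy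
  obtain ⟨c, rfl⟩ := Cell.exists_word hm hn l h0 hl
  exact ⟨box K c, toWords_box K c⟩

/-- On a box both sides merge neighbouring blocks with the signs `(-1) ^ i`. As `m` is positive
there is at least one block, so the number of blocks may be written `k + 1`. -/
theorem toWords_δ (φ : (generators K).X m n) :
    toWords K ((generators K).δ m n φ) = Bar.d (toWords K φ) := by
  refine LinearMap.congr_fun (f := toWords K ∘ₗ (generators K).δ m n) (g := Bar.d ∘ₗ toWords K)
    (generators_ext K ?_) φ
  rintro ⟨k, f, hf, hm, hn⟩
  obtain _ | k := k
  · exact (f ⟨0, hm⟩).elim0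
  · rw [LinearMap.comp_apply, LinearMap.comp_apply, δ_box, toWords_box, Bar.d_single, Cell.word,
      Bar.dWord_ofFn, map_sum]
    refine Finset.sum_congr rfl fun i _ => ?_
    rw [map_smul, toWords_box, Cell.word, block_predAbove]

/-! ### The alternating sum of vertices spans the cohomology -/

/-- The signed sum of the vertices of the permutahedron, with the condition `n = 0` as a
hypothesis. -/
noncomputable def skewCocycle (hm : 0 < m) (hn : n = 0) : (generators K).X m n :=
  ∑ σ : Perm (Fin m), ((Perm.sign σ : ℤ) : K) • box K ⟨m, σ.symm, σ.symm.surjective, hm, hn⟩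

theorem act_skewCocycle (hm : 0 < m) (hn : n = 0) (g : Perm (Fin m) × Perm (Fin n)) :
    (generators K).act m n g (skewCocycle K hm hn) =
      ((Perm.sign g.1 : ℤ) : K) • skewCocycle K hm hn := by
  rw [skewCocycle, map_sum, Finset.smul_sum]
  refine Fintype.sum_equiv (Equiv.mulLeft g.1) _ _ fun σ => ?_
  rw [map_smul, act_box, smul_smul, Equiv.coe_mulLeft, Perm.sign_mul]
  have h := Cell.units_mul_self K (Perm.sign g.1)
  congr 1
  push_cast
  linear_combination - ((Perm.sign σ : ℤ) : K) * h

/-- Merging the blocks at positions `i` and `i + 1` does not see their order. The vertices `σ` and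
`σ * swap i.castSucc i.succ` thus have the same face there, with opposite signs. -/
theorem δ_skewCocycle (hm : 0 < m) (hn : n = 0) :
    (generators K).δ m n (skewCocycle K hm hn) = 0 := by
  obtain _ | k := m
  · exact absurd hm (lt_irrefl 0)
  simp only [skewCocycle, map_sum, map_smul, δ_box, Finset.smul_sum]
  rw [Finset.sum_comm]
  refine Finset.sum_eq_zero fun i _ => ?_
  have hs : i.castSucc ≠ i.succ := Fin.castSucc_lt_succ.ne
  have hi : ∀ σ : Perm (Fin (k + 1)),
      i.predAbove ∘ (σ * swap i.castSucc i.succ).symm = i.predAbove ∘ σ.symm := by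
    intro σ
    funext x
    change i.predAbove (swap i.castSucc i.succ (σ.symm x)) = i.predAbove (σ.symm x)
    rw [swap_apply_def]
    split_ifs with h1 h2
    · rw [h1, Fin.predAbove_castSucc_self, Fin.predAbove_succ_self]
    · rw [h2, Fin.predAbove_castSucc_self, Fin.predAbove_succ_self]
    · rfl
  refine Finset.sum_involution (fun σ _ => σ * swap i.castSucc i.succ) ?_ ?_ ?_ ?_
  · intro σ _
    simp only [hi, Perm.sign_mul, Perm.sign_swap hs]
    rw [← add_smul]
    simp
  · intro σ _ _ h
    exact hs (swap_eq_one_iff.1 (mul_eq_left.1 h))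
  · intro σ _
    exact Finset.mem_univ _
  · intro σ _
    rw [mul_assoc, swap_mul_self, mul_one]

/-- A coboundary involves only cells with fewer than `m` blocks, so its coefficient at the vertex of
the identity vanishes. In the signed sum this coefficient is `1`. -/
theorem skewCocycle_ne_δ (hm : 0 < m) (hn : n = 0) (y : (generators K).X m n) :
    skewCocycle K hm hn ≠ (generators K).δ m n y := by
  intro h
  let c : Cell m n := ⟨m, (1 : Perm (Fin m)).symm, (1 : Perm (Fin m)).symm.surjective, hm, hn⟩
  have h1 : coeff K c ∘ₗ (generators K).δ m n = 0 := by
    refine generators_ext K ?_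
    rintro ⟨k, f, hf, hm, hn⟩
    obtain _ | k := k
    · exact (f ⟨0, hm⟩).elim0
    rw [LinearMap.comp_apply, δ_box, map_sum, LinearMap.zero_apply]
    refine Finset.sum_eq_zero fun i _ => ?_
    rw [map_smul, coeff_box_of_ne, smul_zero]
    intro h
    have h2 : m = k := congrArg Cell.k h
    have h3 : k + 1 ≤ m := Cell.k_le (⟨k + 1, f, hf, hm, hn⟩ : Cell m n)
    omega
  have h2 : coeff K c (skewCocycle K hm hn) = 1 := by
    rw [skewCocycle, map_sum, Finset.sum_eq_single 1]
    · rw [map_smul, coeff_box_self]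
      simp
    · intro σ _ hσ
      rw [map_smul, coeff_box_of_ne, smul_zero]
      intro h
      simp only [c, Cell.mk.injEq, heq_eq_eq, true_and] at h
      exact hσ (Equiv.symm_bijective.injective (DFunLike.coe_injective h.symm))
    · intro h
      exact absurd (Finset.mem_univ _) h
  rw [h] at h2
  exact zero_ne_one ((LinearMap.congr_fun h1 y).symm.trans h2)

/-- Both `x` and the signed sum are multiples of one element `w` of the bar complex, up to
coboundaries. The multiple for the signed sum is nonzero, so `w` can be eliminated. -/
theorem exists_eq_smul_skewCocycle (hm : 0 < m) (hn : n = 0)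
    (x : (generators K).X m n) (hx : (generators K).δ m n x = 0) :
    ∃ (c : K) (y : _), x = c • skewCocycle K hm hn + (generators K).δ m n y := by
  obtain ⟨w, hw⟩ := Bar.exists_generator (K := K) (Finset.univ : Finset (Fin m)).val
  have key : ∀ x : (generators K).X m n, (generators K).δ m n x = 0 →
      ∃ (c : K) (y : (generators K).X m n),
        toWords K x = c • w + toWords K ((generators K).δ m n y) := by
    intro x hx
    obtain ⟨c, y, hy, h⟩ := hw _ (toWords_mem K x) (by rw [← toWords_δ, hx, map_zero])
    obtain ⟨y, rfl⟩ := exists_toWords K hm hn y hy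
    exact ⟨c, y, by rw [h, toWords_δ]⟩
  obtain ⟨c, y, h⟩ := key x hx
  obtain ⟨c', y', h'⟩ := key _ (δ_skewCocycle K hm hn)
  have hc : c' ≠ 0 := by
    rintro rfl
    rw [zero_smul, zero_add] at h'
    exact skewCocycle_ne_δ K hm hn y' (toWords_injective K h')
  refine ⟨c / c', y - (c / c') • y', toWords_injective K ?_⟩
  rw [map_sub, map_add, map_sub, map_smul, map_smul, map_smul, h', h, smul_add, smul_smul,
    div_mul_cancel₀ c hc]
  abel

end Transfer

/-! ### Properads without inputs -/

namespace DirGraph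

variable {m n : ℕ}

theorem corolla_wire_inl (σ : Perm (Fin m)) (τ : Perm (Fin n)) (v : Fin 1) (a : Fin m) :
    (corolla σ τ).wire (Sum.inl ⟨v, a⟩) = Sum.inr (σ a) := by
  obtain rfl : v = 0 := Subsingleton.elim _ _
  rfl

theorem corolla_wire_inr (σ : Perm (Fin m)) (τ : Perm (Fin n)) (v : Fin 1) (i : Fin n) :
    (corolla σ τ).wire (Sum.inr i) = Sum.inl ⟨v, τ.symm i⟩ := by
  obtain rfl : v = 0 := Subsingleton.elim _ _
  rfl

/-- The wiring shows both labellings. Hence the labels chosen in `singleMu` are the only ones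
possible. -/
theorem corolla_injective {σ σ' : Perm (Fin m)} {τ τ' : Perm (Fin n)}
    (h : corolla σ τ = corolla σ' τ') : σ = σ' ∧ τ = τ' := by
  have h1 := h
  simp only [corolla, DirGraph.mk.injEq, heq_eq_eq, true_and] at h1
  have h2 : (corolla σ τ).wire = (corolla σ' τ').wire := h1
  refine ⟨Equiv.ext fun a => ?_, Equiv.symm_bijective.injective (Equiv.ext fun i => ?_)⟩
  · have h3 := congrArg (fun e => e (Sum.inl ⟨(0 : Fin 1), a⟩)) h2
    exact Sum.inr_injective h3
  · have h3 := congrArg (fun e => e (Sum.inr i)) h2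
    have h4 := (corolla_wire_inr σ τ 0 i).symm.trans (h3.trans (corolla_wire_inr σ' τ' 0 i))
    exact eq_of_heq (Sigma.mk.inj (Sum.inl_injective h4)).2

/-- A wiring of one vertex that relabels the outputs by `σ` and the inputs by `τ`. -/
theorem mk_eq_corolla (wire : ((Σ _ : Fin 1, Fin m) ⊕ Fin n) ≃ ((Σ _ : Fin 1, Fin n) ⊕ Fin m))
    (σ : Perm (Fin m)) (τ : Perm (Fin n)) (h1 : ∀ j, wire (Sum.inl ⟨0, j⟩) = Sum.inr (σ j))
    (h2 : ∀ i, wire (Sum.inr i) = Sum.inl ⟨0, τ.symm i⟩) :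
    (⟨1, fun _ => m, fun _ => n, wire⟩ : DirGraph m n) = corolla σ τ := by
  have : wire = (corolla σ τ).wire := by
    refine Equiv.ext ?_
    rintro (⟨v, a⟩ | i)
    · obtain rfl : v = 0 := Subsingleton.elim _ _
      exact (h1 a).trans (corolla_wire_inl σ τ 0 a).symm
    · exact (h2 i).trans (corolla_wire_inr σ τ 0 i).symm
  rw [this]
  rfl

/-- Acyclicity forbids loops at the only vertex, so its outputs end at output legs. No input leg
runs straight to an output leg, so input legs end at the vertex. The wiring is thus a pair of
bijections. -/
theorem IsProperadic.eq_corolla {G : DirGraph m n} (hG : G.IsProperadic) (hk : G.k = 1) :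
    ∃ σ τ, G = corolla σ τ := by
  obtain ⟨k, out, inn, wire⟩ := G
  dsimp only at hk
  subst hk
  have h1 : ∀ a, ∃ j, wire (Sum.inl ⟨0, a⟩) = Sum.inr j := by
    intro a
    rcases h : wire (Sum.inl ⟨0, a⟩) with ⟨w, b⟩ | j
    · obtain rfl : w = 0 := Subsingleton.elim _ _
      exact absurd (Relation.TransGen.single ⟨a, b, h⟩) (hG.acyclic 0)
    · exact ⟨j, rfl⟩
  have h2 : ∀ i, ∃ b, wire (Sum.inr i) = Sum.inl ⟨0, b⟩ := by
    intro i
    rcases h : wire (Sum.inr i) with ⟨w, b⟩ | j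
    · obtain rfl : w = 0 := Subsingleton.elim _ _
      exact ⟨b, rfl⟩
    · exact absurd h (hG.noThrough i j)
  choose f hf using h1
  choose g hg using h2
  have hf' : Function.Bijective f := by
    refine ⟨fun a b h => ?_, fun j => ?_⟩
    · have h3 := wire.injective ((hf a).trans ((congrArg Sum.inr h).trans (hf b).symm))
      exact eq_of_heq (Sigma.mk.inj (Sum.inl_injective h3)).2
    · rcases h : wire.symm (Sum.inr j) with ⟨w, a⟩ | i
      · obtain rfl : w = 0 := Subsingleton.elim _ _
        refine ⟨a, Sum.inr_injective ((hf a).symm.trans ?_)⟩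
        rw [← h, apply_symm_apply]
      · refine absurd ?_ (hG.noThrough i j)
        change wire (Sum.inr i) = _
        rw [← h, apply_symm_apply]
  have hg' : Function.Bijective g := by
    refine ⟨fun a b h => ?_, fun b => ?_⟩
    · refine Sum.inr_injective (wire.injective ((hg a).trans (Eq.trans ?_ (hg b).symm)))
      rw [h]
    · rcases h : wire.symm (Sum.inl ⟨0, b⟩) with ⟨w, a⟩ | i
      · obtain rfl : w = 0 := Subsingleton.elim _ _
        have h3 := hf a
        rw [← h, apply_symm_apply] at h3
        exact absurd h3 Sum.inl_ne_inr
      · refine ⟨i, ?_⟩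
        have h3 := hg i
        rw [← h, apply_symm_apply] at h3
        exact (eq_of_heq (Sigma.mk.inj (Sum.inl_injective h3)).2).symm
  -- Counting turns the bijections into equalities of arities, so the graph literally equals a
  -- corolla.
  obtain rfl : out = fun _ => m := by
    funext v
    obtain rfl : v = 0 := Subsingleton.elim _ _
    simpa using Fintype.card_of_bijective hf'
  obtain rfl : inn = fun _ => n := by
    funext v
    obtain rfl : v = 0 := Subsingleton.elim _ _
    simpa using (Fintype.card_of_bijective hg').symm
  exact ⟨Equiv.ofBijective f hf', (Equiv.ofBijective g hg').symm, mk_eq_corolla wire _ _ hf hg⟩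

/-- A properadic graph with several vertices has an internal edge. -/
theorem IsProperadic.exists_inn_pos {G : DirGraph m n} (hG : G.IsProperadic) (hk : G.k ≠ 1) :
    ∃ v, 0 < G.inn v := by
  by_contra! h
  -- Without inputs there are no edges, and the connectedness relation is equality.
  have hE : ∀ v w, Relation.EqvGen G.Edge v w → v = w := by
    intro v w hvw
    induction hvw with
    | rel v w hvw =>
      obtain ⟨a, b, _⟩ := hvw
      have := b.isLt
      have := h w
      omega
    | refl v => rfl
    | symm v w _ ih => exact ih.symm
    | trans u v w _ _ ih1 ih2 => exact ih1.trans ih2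
  have hp := hG.pos
  have := hE ⟨0, hp⟩ ⟨1, by omega⟩ (hG.connected _ _)
  simp at this

end DirGraph

open DirGraph

variable {K : Type u} [Field K]

/-- An S-bimodule that vanishes in the arities with inputs. -/
def SBimodule.NoInputs (E : SBimodule K) : Prop := ∀ m n, 0 < n → Subsingleton (E.X m n)

/-- Some vertex has an input, so its decoration is zero, which kills any multilinear map. This is
why compositions along larger graphs play no role. -/
theorem mu_eq_zero {E : SBimodule K} (hE : E.NoInputs) {m n : ℕ} {G : DirGraph m n}
    (hG : G.IsProperadic) (hk : G.k ≠ 1) {N : Type u} [AddCommGroup N] [Module K N]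
    (f : MultilinearMap K (fun v => E.X (G.out v) (G.inn v)) N)
    (a : ∀ v, E.X (G.out v) (G.inn v)) : f a = 0 := by
  obtain ⟨v, hv⟩ := hG.exists_inn_pos hk
  have := hE (G.out v) (G.inn v) hv
  exact f.map_coord_zero v (Subsingleton.elim _ _)

theorem koszulSign_eq_one {k : ℕ} (hk : k = 1) (d : Fin k → ℤ) (e : Perm (Fin k)) :
    koszulSign d e = 1 := by
  refine Finset.prod_eq_one fun i _ => Finset.prod_eq_one fun j hj => ?_
  have := Finset.mem_Ioi.1 hj
  omega

/-! ### The properad whose only compositions are relabellings -/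

namespace SBimodule

variable (E : SBimodule K) {m n : ℕ}

/-- The composition along a corolla. -/
noncomputable def corollaMu (σ : Perm (Fin m)) (τ : Perm (Fin n)) : MultilinearMap K
    (fun v => E.X ((corolla σ τ).out v) ((corolla σ τ).inn v)) (E.X m n) :=
  (E.act m n (σ, τ)).compMultilinearMap
    (MultilinearMap.ofSubsingleton K (E.X m n) (E.X m n) (0 : Fin 1) LinearMap.id)

open Classical in
/-- The composition that is nonzero only along corollas. -/
noncomputable def singleMu (G : DirGraph m n) :
    MultilinearMap K (fun v => E.X (G.out v) (G.inn v)) (E.X m n) :=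
  -- The type of decorations depends on the graph, so the composition is transported along the
  -- equation of graphs.
  if h : ∃ p : Perm (Fin m) × Perm (Fin n), corolla p.1 p.2 = G then
    Eq.rec (motive := fun G _ => MultilinearMap K (fun v => E.X (G.out v) (G.inn v)) (E.X m n))
      (E.corollaMu h.choose.1 h.choose.2) h.choose_spec
  else 0

theorem singleMu_corolla (σ : Perm (Fin m)) (τ : Perm (Fin n)) :
    E.singleMu (corolla σ τ) = E.corollaMu σ τ := by
  have h : ∃ p : Perm (Fin m) × Perm (Fin n), corolla p.1 p.2 = corolla σ τ := ⟨(σ, τ), rfl⟩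
  rw [singleMu, dif_pos h]
  have key : ∀ (σ' : Perm (Fin m)) (τ' : Perm (Fin n)) (e : corolla σ' τ' = corolla σ τ),
      Eq.rec (motive := fun G _ => MultilinearMap K (fun v => E.X (G.out v) (G.inn v)) (E.X m n))
        (E.corollaMu σ' τ') e = E.corollaMu σ τ := by
    intro σ' τ' e
    obtain ⟨rfl, rfl⟩ := corolla_injective e
    rfl
  exact key _ _ _

theorem singleMu_corolla_apply (σ : Perm (Fin m)) (τ : Perm (Fin n))
    (a : ∀ v, E.X ((corolla σ τ).out v) ((corolla σ τ).inn v)) :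
    E.singleMu (corolla σ τ) a = E.act m n (σ, τ) (a (0 : Fin 1)) := by
  rw [singleMu_corolla]
  rfl

/-- Renumbering and substitution yield one-vertex graphs that are not syntactically corollas: the
number of vertices may be a sum, and the wiring is composite. This form asks only where the
half-edges go. -/
theorem singleMu_mk {k : ℕ} (hk : k = 1)
    (wire : ((Σ _ : Fin k, Fin m) ⊕ Fin n) ≃ ((Σ _ : Fin k, Fin n) ⊕ Fin m))
    (σ : Perm (Fin m)) (τ : Perm (Fin n)) (u : Fin k)
    (h1 : ∀ j, wire (Sum.inl ⟨u, j⟩) = Sum.inr (σ j))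
    (h2 : ∀ i, wire (Sum.inr i) = Sum.inl ⟨u, τ.symm i⟩) (a : Fin k → E.X m n) :
    E.singleMu ⟨k, fun _ => m, fun _ => n, wire⟩ a = E.act m n (σ, τ) (a u) := by
  subst hk
  obtain rfl : u = 0 := Subsingleton.elim _ _
  have h3 := mk_eq_corolla wire σ τ h1 h2
  have h4 : wire = (corolla σ τ).wire := by
    have h5 := h3
    simp only [corolla, DirGraph.mk.injEq, heq_eq_eq, true_and] at h5
    exact h5
  subst h4
  exact E.singleMu_corolla_apply σ τ a

theorem trans_symm_apply {α β γ δ : Type*} (A : α ≃ β) (W : β ≃ γ) (B : δ ≃ γ) {x : α} {y : δ}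
    (h : W (A x) = B y) : ((A.trans W).trans B.symm) x = y := by
  simp [h]

theorem singleMu_reorder (σ : Perm (Fin m)) (τ : Perm (Fin n)) (a : Fin 1 → E.X m n) :
    E.singleMu ((corolla σ τ).reorder (Equiv.refl (Fin 1))) a = E.act m n (σ, τ) (a 0) := by
  refine E.singleMu_mk rfl ((corolla σ τ).reorder (Equiv.refl (Fin 1))).wire σ τ (0 : Fin 1)
    (fun j => ?_) (fun i => ?_) a
  · refine trans_symm_apply _ _ _ ?_
    exact corolla_wire_inl σ τ 0 j
  · refine trans_symm_apply _ _ _ ?_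
    exact corolla_wire_inr σ τ 0 i

/-- The contraction conditions on legs determine the wiring `W`: labels compose to `σ * σ'` and `τ *
τ'`. Associativity is then multiplicativity of the action. -/
theorem singleMu_total (σ σ' : Perm (Fin m)) (τ τ' : Perm (Fin n))
    (W : (corolla σ τ).TotalWiring fun _ => corolla σ' τ')
    (hc : (corolla σ τ).IsContraction (fun _ => corolla σ' τ') W) (a : Fin 1 → Fin 1 → E.X m n) :
    E.singleMu ((corolla σ τ).total (fun _ => corolla σ' τ') W)
      (fun u => a (finSigmaFinEquiv.symm u).1 (finSigmaFinEquiv.symm u).2) =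
      E.act m n (σ, τ) (E.act m n (σ', τ') (a 0 0)) := by
  have hk : ((corolla σ τ).total (fun _ => corolla σ' τ') W).k = 1 :=
    Fin.sum_univ_one (M := ℕ) fun _ => 1
  let x : Σ _ : Fin 1, Fin 1 := ⟨0, 0⟩
  have hx : finSigmaFinEquiv.symm (finSigmaFinEquiv (n := fun _ : Fin 1 => 1) x) = x :=
    Equiv.symm_apply_apply _ _
  refine (E.singleMu_mk hk ((corolla σ τ).total (fun _ => corolla σ' τ') W).wire
    (σ * σ') (τ * τ') (finSigmaFinEquiv (n := fun _ : Fin 1 => 1) x) (fun j => ?_)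
    (fun i => ?_) _).trans ?_
  · refine trans_symm_apply _ _ _ ?_
    refine hc.outLeg _ _ j (σ' j) (σ (σ' j)) ?_ ?_
    · exact corolla_wire_inl σ' τ' _ j
    · exact corolla_wire_inl σ τ _ (σ' j)
  · refine trans_symm_apply _ _ _ ?_
    refine hc.inLeg i _ (τ.symm i) _ (τ'.symm (τ.symm i)) ?_ ?_
    · exact corolla_wire_inr σ τ _ i
    · exact corolla_wire_inr σ' τ' _ (τ.symm i)
  · refine (congrArg (fun y : Σ _ : Fin 1, Fin 1 =>
      E.act m n (σ * σ', τ * τ') (a y.1 y.2)) hx).trans ?_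
    exact congrArg (fun f : E.X m n →ₗ[K] E.X m n => f (a 0 0))
      ((E.act m n).map_mul (σ, τ) (σ', τ'))

/-- An S-bimodule without inputs is a properad: there are no compositions besides the relabelling
of legs. -/
noncomputable def single (hE : E.NoInputs) : Properad K where
  toSBimodule := E
  mu G _ := E.singleMu G
  mu_mem := by
    intro m n G hG d a ha
    by_cases hk : G.k = 1
    · obtain ⟨σ, τ, rfl⟩ := hG.eq_corolla hk
      rw [singleMu_corolla_apply]
      have : ∑ v, d v = d (0 : Fin 1) := Fin.sum_univ_one (M := ℤ) d
      rw [this]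
      exact E.act_mem _ (ha (0 : Fin 1))
    · rw [mu_eq_zero hE hG hk]
      exact Submodule.zero_mem _
  mu_corolla σ τ h x := E.singleMu_corolla_apply σ τ _
  mu_reorder := by
    intro m n G hG e he d a ha
    by_cases hk : G.k = 1
    · rw [koszulSign_eq_one hk, one_smul]
      obtain ⟨σ, τ, rfl⟩ := hG.eq_corolla hk
      obtain rfl : e = Equiv.refl _ := Subsingleton.elim (α := Perm (Fin 1)) _ _
      rw [singleMu_corolla_apply]
      exact E.singleMu_reorder σ τ a
    · rw [mu_eq_zero hE hG hk, smul_zero]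
      exact mu_eq_zero hE he hk _ _
  mu_total := by
    intro m n G hG H hH W hW hc a
    have hpos : ∀ w, 1 ≤ (H w).k := fun w => (hH w).pos
    by_cases hk : G.k = 1
    · obtain ⟨σ, τ, rfl⟩ := hG.eq_corolla hk
      by_cases hk' : (H (0 : Fin 1)).k = 1
      · obtain ⟨σ', τ', h⟩ := (hH (0 : Fin 1)).eq_corolla hk'
        obtain rfl : H = fun _ => corolla σ' τ' := by
          funext w
          obtain rfl : w = (0 : Fin 1) := Subsingleton.elim (α := Fin 1) _ _
          exact h
        rw [singleMu_corolla_apply, singleMu_corolla_apply]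
        exact E.singleMu_total σ σ' τ τ' W hc a
      -- The subgraph has several vertices, hence so does the total graph, and both sides vanish.
      · have hk'' : ((corolla σ τ).total H W).k ≠ 1 := by
          have : ∑ w : Fin 1, (H w).k = (H (0 : Fin 1)).k :=
            Fin.sum_univ_one (M := ℕ) fun w : Fin 1 => (H w).k
          exact fun h => hk' (this.symm.trans h)
        rw [singleMu_corolla_apply, mu_eq_zero hE (hH (0 : Fin 1)) hk']
        exact (mu_eq_zero hE hW hk'' _ _).trans (map_zero (E.act m n (σ, τ))).symm
    -- Each subgraph has a vertex, so the total graph has at least as many vertices as `G`, hence at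
    -- least two.
    · have hk' : (G.total H W).k ≠ 1 := by
        have h1 : ∑ _w : Fin G.k, 1 ≤ ∑ w, (H w).k := Finset.sum_le_sum fun w _ => hpos w
        have h2 : (G.total H W).k = ∑ w, (H w).k := rfl
        have h3 := hG.pos
        simp only [Finset.sum_const, Finset.card_univ, Fintype.card_fin, smul_eq_mul, mul_one] at h1
        omega
      rw [mu_eq_zero hE hG hk]
      exact mu_eq_zero hE hW hk' _ _

end SBimodule

/-- Along a corolla the Leibniz sum has one term, with an empty sum in the exponent of its sign, and
the claim is equivariance of the differential. Along other graphs both sides vanish. -/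
theorem DGSBimodule.δ_singleMu (E : DGSBimodule K) (hE : E.NoInputs) {m n : ℕ}
    (G : DirGraph m n) (hG : G.IsProperadic) (d : Fin G.k → ℤ)
    (a : ∀ v, E.X (G.out v) (G.inn v)) :
    E.δ m n (E.singleMu G a) = ∑ v, (∑ w ∈ Finset.Iio v, d w).negOnePow •
      E.singleMu G (Function.update a v (E.δ _ _ (a v))) := by
  by_cases hk : G.k = 1
  · obtain ⟨σ, τ, rfl⟩ := hG.eq_corolla hk
    rw [SBimodule.singleMu_corolla_apply]
    refine (E.δ_act (σ, τ) (a (0 : Fin 1))).trans ?_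
    refine Eq.trans ?_ (Fin.sum_univ_one (M := E.X m n) _).symm
    have h : ∀ d : Fin 1 → ℤ, (∑ w ∈ Finset.Iio 0, d w).negOnePow = 1 := by
      intro d
      rw [Finset.sum_eq_zero fun w hw => absurd (Finset.mem_Iio.1 hw) (Fin.not_lt_zero w),
        Int.negOnePow_zero]
    refine Eq.trans ?_ (congrArg (fun s : ℤˣ => s • E.singleMu (corolla σ τ)
      (Function.update a (0 : Fin 1) (E.δ m n (a (0 : Fin 1))))) (h d)).symm
    rw [one_smul, SBimodule.singleMu_corolla_apply]
    exact congrArg (E.act m n (σ, τ)) (Function.update_self (β := fun _ : Fin 1 => E.X m n)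
      (0 : Fin 1) (E.δ m n (a (0 : Fin 1))) a).symm
  · rw [mu_eq_zero hE hG hk, map_zero]
    refine (Finset.sum_eq_zero fun v _ => ?_).symm
    rw [mu_eq_zero hE hG hk, smul_zero]

/-- A dg S-bimodule without inputs is a dg properad. -/
noncomputable def DGSBimodule.single (E : DGSBimodule K) (hE : E.NoInputs) : DGProperad K where
  toProperad := E.toSBimodule.single hE
  δ := E.δ
  δ_mem := E.δ_mem
  δ_δ := E.δ_δ
  δ_act := E.δ_act
  leibniz G hG d a _ := E.δ_singleMu hE G hG d a

/-! ### Morphisms -/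

@[ext] theorem Properad.Hom.ext {P Q : Properad K} {f g : Properad.Hom P Q}
    (h : ∀ m n x, f.map m n x = g.map m n x) : f = g := by
  obtain ⟨⟨f, h1, h2⟩, h3⟩ := f
  obtain ⟨⟨g, h4, h5⟩, h6⟩ := g
  obtain rfl : f = g := funext fun m => funext fun n => LinearMap.ext fun x => h m n x
  rfl

/-- The identity morphism of an S-bimodule. -/
def SBimodule.Hom.id (E : SBimodule K) : SBimodule.Hom E E where
  map _ _ := LinearMap.id
  map_mem h := h
  map_act _ _ := rfl

/-- The identity morphism of a properad. -/
def Properad.Hom.id (P : Properad K) : Properad.Hom P P where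
  toHom := SBimodule.Hom.id P.toSBimodule
  map_mu _ _ _ := rfl

/-- The composition of morphisms of properads. -/
def Properad.Hom.comp {P Q R : Properad K} (g : Properad.Hom Q R) (f : Properad.Hom P Q) :
    Properad.Hom P R where
  map m n := g.map m n ∘ₗ f.map m n
  map_mem h := g.map_mem (f.map_mem h)
  map_act s x := by rw [LinearMap.comp_apply, f.map_act, g.map_act]; rfl
  map_mu G hG a := by rw [LinearMap.comp_apply, f.map_mu, g.map_mu]; rfl

/-- A bijective morphism of graded modules reflects degrees. -/
theorem SBimodule.Hom.mem_of_map_mem {E F : SBimodule K} (j : SBimodule.Hom E F) {m n : ℕ}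
    (hj : Function.Injective (j.map m n)) {d : ℤ} {x : E.X m n}
    (hx : j.map m n x ∈ F.deg m n d) : x ∈ E.deg m n d := by
  obtain ⟨p, h1, h2, h3, h4⟩ := exists_proj (E.isInternal m n)
  obtain ⟨q, k1, k2, k3, k4⟩ := exists_proj (F.isInternal m n)
  obtain ⟨s, hs⟩ := h4 x
  -- A degree-preserving map commutes with the projections to homogeneous components; injectivity
  -- then gives `x = p d x`.
  have h5 : ∀ e, j.map m n (p e x) = q e (j.map m n x) := by
    intro e
    have h6 : j.map m n x = ∑ i ∈ s, j.map m n (p i x) := by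
      rw [← map_sum, ← hs]
    rw [h6, map_sum]
    by_cases he : e ∈ s
    · rw [Finset.sum_eq_single_of_mem e he, k2 _ _ (j.map_mem (h1 e x))]
      intro i _ hi
      exact k3 _ _ _ (j.map_mem (h1 i x)) (Ne.symm hi)
    · rw [Finset.sum_eq_zero]
      · have : p e x = 0 := by
          rw [hs, map_sum]
          refine Finset.sum_eq_zero fun i hi => h3 _ _ _ (h1 i x) ?_
          rintro rfl
          exact he hi
        rw [this, map_zero]
      · intro i hi
        refine k3 _ _ _ (j.map_mem (h1 i x)) ?_
        rintro rfl
        exact he hi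
  have h6 : x = p d x := hj (by rw [h5, k2 _ _ hx])
  rw [h6]
  exact h1 d x

/-- A properad without inputs is free on every S-bimodule that is isomorphic to it. -/
theorem Properad.isFree_of_bijective {E : SBimodule K} {P : Properad K}
    (hP : P.NoInputs) (j : SBimodule.Hom E P.toSBimodule)
    (hj : ∀ m n, Function.Bijective (j.map m n)) : Properad.IsFree j := by
  intro Q f
  let e : ∀ m n, E.X m n ≃ₗ[K] P.X m n := fun m n => LinearEquiv.ofBijective (j.map m n) (hj m n)
  have he : ∀ m n x, j.map m n ((e m n).symm x) = x := fun m n x => (e m n).apply_symm_apply x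
  have he' : ∀ m n x, (e m n).symm (j.map m n x) = x := fun m n x => (e m n).symm_apply_apply x
  have hact : ∀ {m n : ℕ} (s) (x : P.X m n),
      (e m n).symm (P.act m n s x) = E.act m n s ((e m n).symm x) := by
    intro m n s x
    apply (hj m n).1
    rw [he, j.map_act, he]
  -- The extension must be `f` after the inverse of `j`.
  refine ⟨⟨⟨fun m n => f.map m n ∘ₗ (e m n).symm.toLinearMap, ?_, ?_⟩, ?_⟩, ?_, ?_⟩
  · intro m n d x hx
    refine f.map_mem (j.mem_of_map_mem (hj m n).1 ?_)
    exact (he m n x).symm ▸ hx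
  · intro m n s x
    exact (congrArg (f.map m n) (hact s x)).trans (f.map_act s _)
  · intro m n G hG a
    -- Along corollas, compatibility with composition is equivariance. Along other graphs a
    -- decoration is zero, so the composition in `Q` also vanishes.
    by_cases hk : G.k = 1
    · obtain ⟨σ, τ, rfl⟩ := hG.eq_corolla hk
      obtain ⟨x, rfl⟩ : ∃ x : P.X m n, a = fun _ => x := by
        refine ⟨a (0 : Fin 1), ?_⟩
        funext v
        obtain rfl : v = (0 : Fin 1) := Subsingleton.elim (α := Fin 1) _ _
        rfl
      have h1 := P.mu_corolla σ τ hG x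
      have h2 := Q.mu_corolla σ τ hG (f.map m n ((e m n).symm x))
      refine Eq.trans ?_ h2.symm
      refine (congrArg (fun y => f.map m n ((e m n).symm y)) h1).trans ?_
      exact (congrArg (f.map m n) (hact _ x)).trans (f.map_act _ _)
    · rw [mu_eq_zero hP hG hk, map_zero]
      obtain ⟨v, hv⟩ := hG.exists_inn_pos hk
      have := hP (G.out v) (G.inn v) hv
      refine ((Q.mu G hG).map_coord_zero v ?_).symm
      rw [Subsingleton.elim (a v) 0, map_zero]
  · intro m n x
    exact congrArg (f.map m n) (he' m n x)
  · intro g hg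
    refine Properad.Hom.ext fun m n x => ?_
    rw [← he m n x, hg]
    exact congrArg (f.map m n) (he' m n _).symm

theorem SBimodule.isFree_id (E : SBimodule K) (hE : E.NoInputs) :
    Properad.IsFree (P := E.single hE) (SBimodule.Hom.id E) :=
  Properad.isFree_of_bijective (P := E.single hE) hE _ fun _ _ => Function.bijective_id

/-- A free properad on generators without inputs consists of its generators. -/
theorem Properad.IsFree.bijective {E : SBimodule K} (hE : E.NoInputs) {P : Properad K}
    {ι : SBimodule.Hom E P.toSBimodule} (h : Properad.IsFree ι) (m n : ℕ) :
    Function.Bijective (ι.map m n) := by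
  obtain ⟨g, hg, -⟩ := h (E.single hE) (SBimodule.Hom.id E)
  obtain ⟨g', hg', -⟩ := E.isFree_id hE P ι
  -- The model `E.single hE` is free on `E` too. Both endomorphisms of `P` extend `ι`, so they
  -- agree, and `g` is a two-sided inverse of `ι`.
  have h1 : g'.comp g = Properad.Hom.id P := by
    refine (h P ι).unique (fun m n x => ?_) (fun m n x => rfl)
    exact (congrArg (g'.map m n) (hg m n x)).trans (hg' m n x)
  refine ⟨Function.LeftInverse.injective (g := g.map m n) (hg m n), fun x => ⟨g.map m n x, ?_⟩⟩
  refine (hg' m n (g.map m n x)).symm.trans ?_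
  exact congrArg (fun f : Properad.Hom P P => f.map m n x) h1

/-! ### The cohomology -/

section Cohomology

variable (K : Type u) [Field K]

theorem generators_noInputs : (generators K).NoInputs := by
  intro m n hn
  have : IsEmpty (Cell m n) := ⟨fun c => hn.ne' c.hn⟩
  exact inferInstanceAs (Subsingleton (Module.Dual K (Cell m n →₀ K)))

theorem generators_subsingleton {m n : ℕ} (h : ¬ (n = 0 ∧ 0 < m)) :
    Subsingleton ((generators K).X m n) := by
  have : IsEmpty (Cell m n) := ⟨fun c => h ⟨c.hn, c.pos⟩⟩
  exact inferInstanceAs (Subsingleton (Module.Dual K (Cell m n →₀ K)))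

/-- Vertices are cells of dimension zero, and the parity shift moves cochain degree zero to `-m`. -/
theorem skewCocycle_mem {m n : ℕ} (hm : 0 < m) (hn : n = 0) :
    skewCocycle K hm hn ∈ (generators K).deg m n (-(m : ℤ)) := by
  refine Submodule.sum_mem _ fun σ _ => Submodule.smul_mem _ _ ?_
  intro c hc
  change _ * Finsupp.single c (1 : K) _ = 0
  rw [Finsupp.single_eq_of_ne, mul_zero]
  rintro rfl
  subst hn
  exact hc (by simp)

variable {K} (P : DGProperad K)
  (ι : SBimodule.Hom (generators K).toSBimodule P.toSBimodule)
  (hδ : ∀ m n x, P.δ m n (ι.map m n x) = ι.map m n ((generators K).δ m n x))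

/-- The cocycle of the properad that is given by the signed sum of vertices. -/
noncomputable def skewClass {m n : ℕ} (hm : 0 < m) (hn : n = 0) : P.cocycles m n :=
  ⟨ι.map m n (skewCocycle K hm hn), by
    rw [DGSBimodule.mem_cocycles, hδ, δ_skewCocycle, map_zero]⟩

/-- The map that sends the corollas to the classes of the signed sums of vertices. -/
noncomputable def skewMap (m n : ℕ) : (skewCorollas K).X m n →ₗ[K] P.H m n :=
  show ({_u : Unit // n = 0 ∧ 0 < m} → K) →ₗ[K] P.H m n from
    ∑ u : {_u : Unit // n = 0 ∧ 0 < m},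
      (LinearMap.proj u).smulRight (P.cls m n (skewClass P ι hδ u.2.2 u.2.1))

/-- The coefficient of the corolla in an element of `skewCorollas K`. -/
def corollaCoeff {m n : ℕ} (h : n = 0 ∧ 0 < m) (x : (skewCorollas K).X m n) : K :=
  (show {_u : Unit // n = 0 ∧ 0 < m} → K from x) ⟨(), h⟩

theorem skewMap_apply {m n : ℕ} (h : n = 0 ∧ 0 < m) (x : (skewCorollas K).X m n) :
    skewMap P ι hδ m n x = corollaCoeff h x • P.cls m n (skewClass P ι hδ h.2 h.1) := by
  have key : ∀ x : {_u : Unit // n = 0 ∧ 0 < m} → K,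
      (∑ u : {_u : Unit // n = 0 ∧ 0 < m}, (LinearMap.proj u).smulRight
        (P.cls m n (skewClass P ι hδ u.2.2 u.2.1)) :
          ({_u : Unit // n = 0 ∧ 0 < m} → K) →ₗ[K] P.H m n) x =
        x ⟨(), h⟩ • P.cls m n (skewClass P ι hδ h.2 h.1) := by
    intro x
    rw [LinearMap.sum_apply, Fintype.sum_subsingleton _ ⟨(), h⟩]
    rfl
  exact key x

theorem skewCorollas_eq_zero {m n : ℕ} (h : ¬ (n = 0 ∧ 0 < m)) (x : (skewCorollas K).X m n) :
    x = 0 :=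
  funext fun u => absurd u.2 h

/-- The morphism given by the classes of the signed sums of vertices. -/
noncomputable def skewHom : SBimodule.Hom (skewCorollas K) P.cohomology.toSBimodule where
  map m n := skewMap P ι hδ m n
  map_mem := by
    intro m n d x hx
    change skewMap P ι hδ m n x ∈ P.degH m n d
    by_cases h : n = 0 ∧ 0 < m
    · by_cases hd : d = -(m : ℤ)
      · subst hd
        rw [skewMap_apply P ι hδ h]
        exact Submodule.smul_mem _ _ ⟨_, ι.map_mem (skewCocycle_mem K _ _), rfl⟩
      · have h1 : (skewCorollas K).deg m n d = ⊥ := if_neg hd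
        rw [h1] at hx
        rw [(Submodule.mem_bot K).1 hx, map_zero]
        exact Submodule.zero_mem _
    · rw [skewCorollas_eq_zero h x, map_zero]
      exact Submodule.zero_mem _
  map_act := by
    intro m n g x
    change skewMap P ι hδ m n _ = P.cohomology.act m n g (skewMap P ι hδ m n x)
    by_cases h : n = 0 ∧ 0 < m
    · have h1 : P.cohomology.act m n g (P.cls m n (skewClass P ι hδ h.2 h.1)) =
          P.cls m n (((Perm.sign g.1 : ℤ) : K) • skewClass P ι hδ h.2 h.1) := by
        refine congrArg (P.cls m n) (Subtype.ext ?_)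
        change P.act m n g (ι.map m n _) = ((Perm.sign g.1 : ℤ) : K) • ι.map m n _
        rw [← ι.map_act, act_skewCocycle, map_smul]
      have h2 := (P.cohomology.act m n g).map_smul (corollaCoeff h x)
        (P.cls m n (skewClass P ι hδ h.2 h.1))
      rw [skewMap_apply P ι hδ h x]
      refine (skewMap_apply P ι hδ h _).trans (Eq.trans ?_ h2.symm)
      refine Eq.trans ?_ (congrArg (corollaCoeff h x • ·) h1).symm
      have h3 : (corollaCoeff h x * ((Perm.sign g.1 : ℤ) : K)) •
          P.cls m n (skewClass P ι hδ h.2 h.1) = corollaCoeff h x •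
            P.cls m n (((Perm.sign g.1 : ℤ) : K) • skewClass P ι hδ h.2 h.1) := by
        rw [map_smul, smul_smul]
      exact (congrArg (· • P.cls m n (skewClass P ι hδ h.2 h.1)) (mul_comm _ _)).trans h3
    · rw [skewCorollas_eq_zero h x, map_zero, map_zero]
      exact (map_zero (P.cohomology.act m n g)).symm

theorem skewHom_apply {m n : ℕ} (h : n = 0 ∧ 0 < m) (x : (skewCorollas K).X m n) :
    (skewHom P ι hδ).map m n x = corollaCoeff h x • P.cls m n (skewClass P ι hδ h.2 h.1) :=
  skewMap_apply P ι hδ h x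

/-- The bijection `ι` moves the question to the generators: injectivity is `skewCocycle_ne_δ`,
surjectivity is `exists_eq_smul_skewCocycle`. In the remaining arities both sides are zero. -/
theorem skewHom_bijective (hι : ∀ m n, Function.Bijective (ι.map m n)) (m n : ℕ) :
    Function.Bijective ((skewHom P ι hδ).map m n) := by
  by_cases h : n = 0 ∧ 0 < m
  · constructor
    · refine (injective_iff_map_eq_zero _).2 fun x hx => ?_
      have hx := (skewHom_apply P ι hδ h x).symm.trans hx
      refine funext fun u => ?_
      obtain rfl : u = ⟨(), h⟩ := Subsingleton.elim _ _
      refine (smul_eq_zero.1 (show corollaCoeff h x • P.cls m n (skewClass P ι hδ h.2 h.1) = 0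
        from hx)).resolve_right fun h0 => ?_
      obtain ⟨b, hb⟩ := (P.cls_eq_iff).1 (h0.trans (map_zero (P.cls m n)).symm)
      obtain ⟨y, rfl⟩ := (hι m n).2 b
      refine skewCocycle_ne_δ K h.2 h.1 y ((hι m n).1 ?_)
      rw [← hδ, hb]
      exact (sub_zero _).symm
    · intro q
      obtain ⟨⟨z, hz⟩, rfl⟩ := Submodule.mkQ_surjective _ q
      obtain ⟨x, rfl⟩ := (hι m n).2 z
      have hx : (generators K).δ m n x = 0 := by
        apply (hι m n).1
        rw [← hδ, map_zero]
        exact hz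
      obtain ⟨c, y, hxy⟩ := exists_eq_smul_skewCocycle K h.2 h.1 x hx
      refine ⟨(fun _ => c : {_u : Unit // n = 0 ∧ 0 < m} → K), ?_⟩
      refine (skewHom_apply P ι hδ h _).trans ?_
      refine Eq.trans (b := P.cls m n (c • skewClass P ι hδ h.2 h.1)) (map_smul _ _ _).symm ?_
      refine (P.cls_eq_iff).2 ⟨ι.map m n (-y), ?_⟩
      rw [hδ]
      change _ = c • ι.map m n _ - ι.map m n x
      rw [hxy]
      simp only [map_add, map_smul, map_neg]
      abel
  · have h1 : IsEmpty {_u : Unit // n = 0 ∧ 0 < m} := ⟨fun u => h u.2⟩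
    have h2 : Subsingleton ((skewCorollas K).X m n) :=
      inferInstanceAs (Subsingleton ({_u : Unit // n = 0 ∧ 0 < m} → K))
    have h3 := generators_subsingleton K h
    have h4 : Subsingleton (P.X m n) := (hι m n).2.subsingleton
    have h5 : Subsingleton (P.H m n) := (Submodule.mkQ_surjective _).subsingleton
    exact ⟨fun _ _ _ => Subsingleton.elim _ _, fun q => ⟨0, Subsingleton.elim (α := P.H m n) _ _⟩⟩

end Cohomology

end Properadic

theorem theorem3p2p4 (K : Type u) [Field K] [CharZero K] :
    (∃ (P : Properadic.DGProperad K)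
      (ι : Properadic.SBimodule.Hom (Properadic.generators K).toSBimodule P.toSBimodule),
      Properadic.DGProperad.IsFree ι) ∧
    ∀ (P : Properadic.DGProperad K)
      (ι : Properadic.SBimodule.Hom (Properadic.generators K).toSBimodule P.toSBimodule),
      Properadic.DGProperad.IsFree ι →
      ∃ (hcocycle : ∀ (m : ℕ) (hm : 0 < m),
          ι.map m 0 (Properadic.vertexSum K hm) ∈ P.cocycles m 0)
        (j : Properadic.SBimodule.Hom (Properadic.skewCorollas K) P.cohomology.toSBimodule),
        (∀ (m : ℕ) (hm : 0 < m), j.map m 0 (Properadic.corollaGen K hm) =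
          P.cls m 0 ⟨ι.map m 0 (Properadic.vertexSum K hm), hcocycle m hm⟩) ∧
        Properadic.Properad.IsFree j := by
  refine ⟨⟨(Properadic.generators K).single (Properadic.generators_noInputs K),
    Properadic.SBimodule.Hom.id _,
    ⟨Properadic.SBimodule.isFree_id _ (Properadic.generators_noInputs K), fun _ _ _ => rfl⟩⟩,
    fun P ι h => ?_⟩
  -- Freeness alone identifies an arbitrary `P` with its generators, so no model has to be chosen.
  have hι := h.free.bijective (Properadic.generators_noInputs K)
  -- With `rfl` for `n = 0`, `skewCocycle` is `vertexSum` by definition.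
  refine ⟨fun m hm => (Properadic.skewClass P ι h.map_δ hm rfl).2,
    Properadic.skewHom P ι h.map_δ, fun m hm => ?_, ?_⟩
  · exact (Properadic.skewHom_apply P ι h.map_δ ⟨rfl, hm⟩ _).trans (one_smul K _)
  · refine Properadic.Properad.isFree_of_bijective (P := P.cohomology) (fun m n hn => ?_) _
      (Properadic.skewHom_bijective P ι h.map_δ hι)
    have h1 := Properadic.generators_noInputs K m n hn
    have h2 : Subsingleton (P.X m n) := (hι m n).2.subsingleton
    exact (Submodule.mkQ_surjective (P.coboundaries m n)).subsingleton
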